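/- For a finite nonabelian group $G$ with center $Z(G)$, let $X(G)$ be the 2-dimensional simplicial complex with vertices $(x,1)$ and $(x,2)$ for all $x\in G\setminus Z(G)$, whose maximal simplices are the triangles $\{(x,1),(y,1),(xy,2)\}$ with $x,y\in G$, $xy\neq yx$. Every edge of $X(G)$ lies in exactly two triangles. Let $Y(G)$ be the desingularization of $X(G)$: each vertex is removed and each resulting puncture is filled in with its own new point. In other words, $Y(G)$ is the simplicial complex whose vertices are the sheets at the vertices $v$ of $X(G)$, i.e. the classes of triangles containing $v$ under the equivalence relation generated by sharing an edge through $v$; every triangle of $X(G)$ gives the triangle of $Y(G)$ spanned by the three sheets in which it lies. A vertex of $Y(G)$ is of type $i$ if it lies over a vertex $(x,i)$ of $X(G)$. Let $\hat Y(G)$ be the same space with the cell structure obtained by erasing all type 2 vertices and all edges joining type 1 to type 2 vertices: its vertices are the type 1 vertices of $Y(G)$, its edges are the edges of $Y(G)$ joining two type 1 vertices, and its 2-cells are the closed stars in $Y(G)$ of the type 2 vertices. The components of $\hat Y(G)$ are its connected components. The poset of a component consists of its closed cells ordered by inclusion, together with a least element (the empty cell) and a greatest element (the whole component). **Theorem.**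 Let $p$ be an odd prime and let $G=U_3(p)$ be the group of upper triangular $3\times 3$ matrices over $\mathbb F_p$ with ones on the diagonal (the extraspecial group of order $p^3$ and exponent $p$). Then: 1. $\hat Y(G)$ has exactly $\frac{(p^2-1)(p^2-p)}{2}$ components, and any two of them are isomorphic as cell complexes (i.e. have isomorphic posets). 2. The poset of each component is a regular abstract $3$-polytope (an abstract polytope of rank $3$ whose automorphism group is transitive on flags) with Schläfli symbol $\{2p,p\}$. 3. Each component is a compact connected orientable surface, without boundary, of genus $\frac{p(p-3)}{2}+1$ (Euler characteristic $3p-p^2$), tessellated by $2p$-gons: the numbers of faces, edges and vertices of the tessellation are $F=p$, $E=p^2$, $V=2p$, each face has $2p$ edges, and each vertex has valency $p$. -/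

import Mathlib

/-! ## The group of unitriangular `3 × 3` matrices -/

/-- The group `U_3(p)` of upper triangular `3 × 3` matrices over `𝔽_p` with ones on the diagonal. -/
def U3 (p : ℕ) [Fact p.Prime] : Subgroup (GL (Fin 3) (ZMod p)) where
  carrier := {A | ∃ a b c : ZMod p,
    (A : Matrix (Fin 3) (Fin 3) (ZMod p)) = !![1, a, b; 0, 1, c; 0, 0, 1]}
  mul_mem' := by
    rintro A B ⟨a, b, c, hA⟩ ⟨a', b', c', hB⟩
    refine ⟨a' + a, b' + a * c' + b, c' + c, ?_⟩
    rw [Units.val_mul, hA, hB]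
    ext i j
    fin_cases i <;> fin_cases j <;> simp [Matrix.mul_apply, Fin.sum_univ_three]
  one_mem' := by
    refine ⟨0, 0, 0, ?_⟩
    ext i j
    fin_cases i <;> fin_cases j <;> simp
  inv_mem' := by
    rintro A ⟨a, b, c, hA⟩
    refine ⟨-a, a * c - b, -c, ?_⟩
    refine Units.inv_eq_of_mul_eq_one_right ?_
    rw [hA]
    ext i j
    fin_cases i <;> fin_cases j <;>
      simp [Matrix.mul_apply, Fin.sum_univ_three]
    ring

/-! ## Abstract simplicial complexes: realization, surfaces, desingularization -/

namespace PreAbstractSimplicialComplex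

variable {V : Type*}

/-- The geometric realization of a finite complex, in barycentric coordinates, with the topology
of pointwise convergence (the usual topology, when the complex is finite). -/
def Realization (K : PreAbstractSimplicialComplex V) : Type _ :=
  {t : V → ℝ // (∀ v, 0 ≤ t v) ∧ ∃ s ∈ K.faces, (∀ v, v ∉ s → t v = 0) ∧ ∑ v ∈ s, t v = 1}

instance (K : PreAbstractSimplicialComplex V) : TopologicalSpace K.Realization :=
  inferInstanceAs (TopologicalSpace {t : V → ℝ //
    (∀ v, 0 ≤ t v) ∧ ∃ s ∈ K.faces, (∀ v, v ∉ s → t v = 0) ∧ ∑ v ∈ s, t v = 1})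

/-- The 1-skeleton of `K`. -/
def oneSkeleton (K : PreAbstractSimplicialComplex V) : SimpleGraph V where
  Adj u v := u ≠ v ∧ ∃ s ∈ K.faces, u ∈ s ∧ v ∈ s
  symm := ⟨fun _ _ h => ⟨h.1.symm, h.2.imp fun _ hs => ⟨hs.1, hs.2.2, hs.2.1⟩⟩⟩
  loopless := ⟨fun _ h => h.1 rfl⟩

/-- The subcomplex of `K` of all simplices with all their vertices in `S`. -/
def restrict (K : PreAbstractSimplicialComplex V) (S : Set V) :
    PreAbstractSimplicialComplex V where
  faces := {s | s ∈ K.faces ∧ (s : Set V) ⊆ S}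
  isRelLowerSet_faces := fun _ hs =>
    ⟨(K.isRelLowerSet_faces hs.1).1, fun _ hts ht =>
      ⟨(K.isRelLowerSet_faces hs.1).2 hts ht, fun _ hv => hs.2 (hts hv)⟩⟩

/-- The number of simplices of dimension `d`. -/
noncomputable def numSimplices (K : PreAbstractSimplicialComplex V) (d : ℕ) : ℕ :=
  {s | s ∈ K.faces ∧ s.card = d + 1}.ncard

/-- `a, b, c` are the three distinct vertices of a 2-simplex of `K`. -/
def IsTriangle (K : PreAbstractSimplicialComplex V) (a b c : V) : Prop :=
  a ≠ b ∧ b ≠ c ∧ a ≠ c ∧ ∃ s ∈ K.faces, (s : Set V) = {a, b, c}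

/-- All 2-simplices can be oriented so that the orientations of any two 2-simplices with a common
edge cancel along that edge. Here `o a b c` says that the cyclic order `a, b, c` is the chosen
orientation of the 2-simplex `{a, b, c}`. -/
def Orientable (K : PreAbstractSimplicialComplex V) : Prop :=
  ∃ o : V → V → V → Prop,
    (∀ a b c, K.IsTriangle a b c → (o a b c ↔ o b c a) ∧ (o a b c ↔ ¬ o b a c)) ∧
    ∀ a b c d, K.IsTriangle a b c → K.IsTriangle a b d → c ≠ d → (o a b c ↔ o b a d)

/-- `K` is a finite triangulation of a compact connected orientable surface (2-manifold without
boundary) of genus `g`, the genus being given by the Euler characteristic `2 - 2g`. -/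
structure IsSurfaceOfGenus (K : PreAbstractSimplicialComplex V) (g : ℕ) : Prop where
  finite : K.faces.Finite
  pure : ∀ s ∈ K.faces, ∃ t ∈ K.faces, s ⊆ t ∧ t.card = 3
  dim_le : ∀ s ∈ K.faces, s.card ≤ 3
  compact : CompactSpace K.Realization
  connected : ConnectedSpace K.Realization
  manifold : Nonempty (ChartedSpace (EuclideanSpace ℝ (Fin 2)) K.Realization)
  orientable : K.Orientable
  euler : (K.numSimplices 0 : ℤ) - K.numSimplices 1 + K.numSimplices 2 = 2 - 2 * (g : ℤ)

/-- A corner of a 2-dimensional complex: a 2-simplex `tri` with one of its vertices `pt`. -/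
structure Corner (K : PreAbstractSimplicialComplex V) where
  tri : Finset V
  pt : V
  tri_mem : tri ∈ K.faces
  card_tri : tri.card = 3
  pt_mem : pt ∈ tri

/-- Two corners at the same vertex whose triangles share an edge through that vertex. -/
def Corner.Adj {K : PreAbstractSimplicialComplex V} (c d : K.Corner) : Prop :=
  c.pt = d.pt ∧ ∃ e ∈ K.faces, e.card = 2 ∧ c.pt ∈ e ∧ e ⊆ c.tri ∧ e ⊆ d.tri

/-- The sheets of the closed stars of the vertices of `K`: a sheet at `v` is a class of triangles
at `v` under the equivalence relation generated by sharing an edge through `v`. If every edge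
lies in exactly two triangles, the sheets at `v` correspond to the circles in the link of `v`,
that is, to the punctures that appear when `v` is removed from the space. -/
def Sheet (K : PreAbstractSimplicialComplex V) : Type _ :=
  Quot (Corner.Adj (K := K))

/-- The vertex of `K` at which a sheet is centered. -/
def Sheet.base {K : PreAbstractSimplicialComplex V} : K.Sheet → V :=
  Quot.lift Corner.pt fun _ _ h => h.1

/-- The desingularization of a 2-dimensional complex: every vertex is removed and each resulting
puncture is filled in with its own point. So the vertices are the sheets of `K`, and every
triangle of `K` gives the triangle formed by the sheets at its vertices in which it lies. -/
def desingularization (K : PreAbstractSimplicialComplex V) :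
    PreAbstractSimplicialComplex K.Sheet where
  faces := {s | s.Nonempty ∧ ∃ σ : Finset V, ∀ u ∈ s, ∃ c : K.Corner, c.tri = σ ∧
    u = Quot.mk _ c}
  isRelLowerSet_faces := fun _ hs =>
    ⟨hs.1, fun _ hts ht => ⟨ht, hs.2.imp fun _ hσ u hu => hσ u (hts hu)⟩⟩

end PreAbstractSimplicialComplex

/-! ## The complexes of a group -/

section GroupComplex

variable (G : Type*) [Group G]

/-- The noncentral elements of `G`. -/
abbrev Noncentral : Type _ := {x : G // x ∉ Subgroup.center G}

/-- The complex `X(G)`: it has vertices `(x,1) = inl x` and `(x,2) = inr x` for `x` noncentral,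
and its maximal simplices are `{(x,1), (y,1), (xy,2)}` for noncommuting `x` and `y`. -/
def complexX : PreAbstractSimplicialComplex (Noncentral G ⊕ Noncentral G) where
  faces := {s | s.Nonempty ∧ ∃ x y z : Noncentral G, (x * y : G) ≠ y * x ∧ (z : G) = x * y ∧
    (s : Set (Noncentral G ⊕ Noncentral G)) ⊆ {Sum.inl x, Sum.inl y, Sum.inr z}}
  isRelLowerSet_faces := fun _ hs => ⟨hs.1, fun _ hts ht => ⟨ht, by
    obtain ⟨x, y, z, h, hz, hsub⟩ := hs.2
    exact ⟨x, y, z, h, hz, fun v hv => hsub (hts hv)⟩⟩⟩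

/-- The desingularization `Y(G)` of `X(G)`. -/
def complexY : PreAbstractSimplicialComplex (complexX G).Sheet :=
  (complexX G).desingularization

/-- The components of `Y(G)`, which are also those of `Ŷ(G)`. -/
abbrev ComponentY : Type _ := (complexY G).oneSkeleton.ConnectedComponent

end GroupComplex

section Cells

variable {G : Type*} [Group G]

/-- The vertex of `Y(G)` lies over a vertex `(x,1)` of `X(G)`. -/
def IsType1 (u : (complexX G).Sheet) : Prop := ∃ x, u.base = Sum.inl x

/-- The vertex of `Y(G)` lies over a vertex `(x,2)` of `X(G)`. -/
def IsType2 (u : (complexX G).Sheet) : Prop := ∃ x, u.base = Sum.inr x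

namespace ComponentY

/-- The triangulation, by simplices of `Y(G)`, of a component. -/
def triangulation (T : ComponentY G) : PreAbstractSimplicialComplex (complexX G).Sheet :=
  (complexY G).restrict T.supp

/-- The vertices of the cell structure `Ŷ(G)` on a component: the type 1 vertices. Closed cells
are written as the sets of the simplices of `Y(G)` that they contain. -/
def vertexCells (T : ComponentY G) : Set (Set (Finset (complexX G).Sheet)) :=
  {c | ∃ s ∈ T.triangulation.faces, s.card = 1 ∧ (∀ u ∈ s, IsType1 u) ∧
    c = {t | t ∈ T.triangulation.faces ∧ t ⊆ s}}

/-- The edges of the cell structure `Ŷ(G)` on a component: the edges joining two type 1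
vertices. -/
def edgeCells (T : ComponentY G) : Set (Set (Finset (complexX G).Sheet)) :=
  {c | ∃ s ∈ T.triangulation.faces, s.card = 2 ∧ (∀ u ∈ s, IsType1 u) ∧
    c = {t | t ∈ T.triangulation.faces ∧ t ⊆ s}}

/-- The 2-cells of the cell structure `Ŷ(G)` on a component: the closed stars of the type 2
vertices. -/
def faceCells (T : ComponentY G) : Set (Set (Finset (complexX G).Sheet)) :=
  {c | ∃ w ∈ T.supp, IsType2 w ∧
    c = {t | t ∈ T.triangulation.faces ∧ ∃ r ∈ T.triangulation.faces, w ∈ r ∧ t ⊆ r}}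

/-- The closed cells of `Ŷ(G)` on a component, extended by the empty cell and by the component
itself, ordered by inclusion. -/
abbrev CellPoset (T : ComponentY G) : Type _ :=
  ↥({∅} ∪ T.vertexCells ∪ T.edgeCells ∪ T.faceCells ∪ {T.triangulation.faces} :
    Set (Set (Finset (complexX G).Sheet)))

end ComponentY

end Cells

/-! ## Abstract polytopes

In a poset with the properties (P1) and (P2) below, a face of rank `i` is an element `F` with
`Order.height F = i + 1`, the least face having rank `-1`. -/

section Polytope

variable (P : Type*) [PartialOrder P]

/-- `P` is an abstract polytope of rank `n`. -/
structure IsAbstractPolytope (n : ℕ) : Prop where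
  /-- (P1) There are a least and a greatest face. -/
  exists_bot : ∃ F : P, IsLeast Set.univ F
  exists_top : ∃ F : P, IsGreatest Set.univ F
  /-- (P2) All flags have `n + 2` faces. -/
  ncard_flag : ∀ Φ : Flag P, (Φ : Set P).ncard = n + 2
  /-- (P3) Every section of rank at least 2 is connected: any two of its proper faces are joined
  by a sequence of proper faces in which successive ones are incident. -/
  connected : ∀ F G : P, F ≤ G → Order.height F + 3 ≤ Order.height G →
    ∀ H ∈ Set.Ioo F G, ∀ K ∈ Set.Ioo F G,
      Relation.ReflTransGen (fun A B => B ∈ Set.Ioo F G ∧ (A ≤ B ∨ B ≤ A)) H K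
  /-- (P4) If the ranks of `F < G` differ by 2, exactly two faces lie strictly between them. -/
  diamond : ∀ F G : P, F < G → Order.height F + 2 = Order.height G → (Set.Ioo F G).ncard = 2

/-- `P` is a regular abstract polytope of rank `n`: its automorphism group is transitive on
flags. -/
def IsRegularPolytope (n : ℕ) : Prop :=
  IsAbstractPolytope P n ∧ MulAction.IsPretransitive (P ≃o P) (Flag P)

/-- The abstract 3-polytope `P` has Schläfli symbol `{a, b}`: every section between the least face
and a 2-face is an `a`-gon, every section between a vertex and the greatest face is a `b`-gon. -/
def HasSchlafliSymbol (a b : ℕ) : Prop :=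
  (∀ F G : P, F ≤ G → Order.height F = 0 → Order.height G = 3 →
    {H | H ∈ Set.Ioo F G ∧ Order.height H = 2}.ncard = a) ∧
  (∀ F G : P, F ≤ G → Order.height F = 1 → Order.height G = 4 →
    {H | H ∈ Set.Ioo F G ∧ Order.height H = 3}.ncard = b)

end Polytope

/-! A triangle of `X(G)` is an ordered pair `(x, y)` of noncommuting elements. Its neighbours are
`(y, x)`, across the edge joining `x` and `y`, and the pairs with the same product that have `x` in
second or `y` in first place. If all commutators are central, `G/Z` is abelian, so any two of the
cosets of `x`, `y`, `xy` determine the third, and the unordered pair `{xZ, yZ}` is constant on a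
component of `Y(G)` (`classes_eq_of_edge`).

Conversely, let `ζ` parametrize the center by `ZMod p`, and let `xy = yx ζ(d)`; then `d ≠ 0`. The
pair `(x ζ(id), y ζ(jd))` has product `xy ζ((i+j)d)`, and the reversed pair has product `xy
ζ((i+j-1)d)`. Crossing edges around `x ζ(id)` therefore reaches every `j`, and likewise at the other
two vertices (`modelPair_sheet`, `modelPair_flip_sheet`). So the component consists of all pairs
over `{xZ, yZ}`, with one sheet for each index at each of the three corners. Indexing the products
by `k = -(i+j)` gives a model independent of the group (`isModel_component`): three colour classes
indexed by `ZMod p`, and triangles `i + j + k = 0` (pairs) or `1` (reversed pairs). This is a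
triangulation with 1-skeleton the complete tripartite graph `K_{p,p,p}`.

Everything else is read off from the model. Each link is a `2p`-gon, so the open stars are planar
charts (`exists_openPartialHomeomorph`, via the fan of the `2p`-th roots of unity). Triangles with a
common edge have different sums, which gives an orientation. The Euler characteristic is `3p - 3p² +
2p²`. Erasing colour 2 leaves a map of `K_{p,p}` with `p` faces, whose poset is `BipartiteCell p`;
shifts, the exchange of the colours and a sign change act transitively on its flags.

For the number of components, each contains `2p²` pairs (`card_fiber`), and two elements of `U3 p`
fail to commute exactly when their superdiagonals form an invertible matrix, so there are `p²
|GL₂(𝔽_p)|` noncommuting pairs (`U3.card_noncommutingPair`). -/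

/-! ## The complete fan spanned by the `n`-th roots of unity -/

section Fan

open Complex

variable {n : ℕ} [NeZero n]

/-- The determinant of two plane vectors. -/
def planeCross (z w : ℂ) : ℝ := z.re * w.im - z.im * w.re

/-- The generator with index `k` of the fan of the `n`-th roots of unity. -/
noncomputable def fanRay (k : ZMod n) : ℂ := (ZMod.toCircle k : ℂ)

theorem fanRay_add (j k : ZMod n) : fanRay (j + k) = fanRay j * fanRay k := by
  simp [fanRay, AddChar.map_add_eq_mul]

theorem normSq_fanRay (j : ZMod n) :
    (fanRay j).re * (fanRay j).re + (fanRay j).im * (fanRay j).im = 1 := by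
  have := Circle.normSq_coe (ZMod.toCircle j)
  rwa [Complex.normSq_apply] at this

theorem fanRay_neg_im (j : ZMod n) : (fanRay (-j)).im = - (fanRay j).im := by
  simp [fanRay, AddChar.map_neg_eq_inv]

/-- The determinant is invariant under the rotation that takes `fanRay j` to `1`. -/
theorem planeCross_fanRay (j k : ZMod n) :
    planeCross (fanRay j) (fanRay k) = (fanRay (k - j)).im := by
  have h : k = j + (k - j) := by ring
  conv_lhs => rw [h, fanRay_add]
  have := normSq_fanRay j
  simp only [planeCross, mul_re, mul_im]
  linear_combination (fanRay (k - j)).im * this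

theorem fanRay_intCast (j : ℤ) :
    fanRay (j : ZMod n) = exp ((j * (2 * Real.pi / n) : ℝ) * I) := by
  rw [fanRay, ZMod.toCircle_intCast]
  congr 1
  push_cast
  ring

theorem fanRay_intCast_im (j : ℤ) :
    (fanRay (j : ZMod n)).im = Real.sin (j * (2 * Real.pi / n)) := by
  rw [fanRay_intCast, exp_ofReal_mul_I_im]

theorem fanRay_intCast_re (j : ℤ) :
    (fanRay (j : ZMod n)).re = Real.cos (j * (2 * Real.pi / n)) := by
  rw [fanRay_intCast, exp_ofReal_mul_I_re]

theorem fanRay_im_nonneg {j : ℤ} (h0 : 0 ≤ j) (h1 : 2 * j ≤ n) :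
    0 ≤ (fanRay (j : ZMod n)).im := by
  have hn : (0 : ℝ) < n := by exact_mod_cast Nat.pos_of_ne_zero (NeZero.ne n)
  rw [fanRay_intCast_im]
  apply Real.sin_nonneg_of_nonneg_of_le_pi
  · have : (0 : ℝ) ≤ j := by exact_mod_cast h0
    positivity
  · have : (2 * j : ℝ) ≤ n := by exact_mod_cast h1
    rw [show (j : ℝ) * (2 * Real.pi / n) = (2 * j) * (Real.pi / n) by ring]
    calc (2 * j : ℝ) * (Real.pi / n) ≤ n * (Real.pi / n) := by gcongr
      _ = Real.pi := by field_simp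

theorem fanRay_im_nonpos {j : ℤ} (h0 : n ≤ 2 * j) (h1 : j ≤ n) :
    (fanRay (j : ZMod n)).im ≤ 0 := by
  have h := fanRay_im_nonneg (n := n) (j := n - j) (by omega) (by omega)
  rw [show ((n - j : ℤ) : ZMod n) = -(j : ZMod n) by push_cast; simp, fanRay_neg_im] at h
  linarith

theorem fanRay_one_im_pos (hn : 3 ≤ n) : 0 < (fanRay (1 : ZMod n)).im := by
  have hn' : (3 : ℝ) ≤ n := by exact_mod_cast hn
  have h := fanRay_intCast_im (n := n) 1
  rw [Int.cast_one] at h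
  rw [h]
  have := Real.pi_pos
  apply Real.sin_pos_of_pos_of_lt_pi
  · push_cast; positivity
  · push_cast
    rw [one_mul, div_lt_iff₀ (by linarith)]
    nlinarith

/-- The piecewise linear function which is `1` at the generator with index `k` of the fan, and `0`
at all others. -/
noncomputable def fanCoord (k : ZMod n) (w : ℂ) : ℝ :=
  max 0 (min (planeCross w (fanRay (k + 1))) (planeCross (fanRay (k - 1)) w)) /
    (fanRay (1 : ZMod n)).im

theorem continuous_fanCoord (k : ZMod n) : Continuous (fanCoord k) := by
  unfold fanCoord planeCross
  fun_prop

/-- On the two cones adjacent to ray `k`, the smaller determinant is the one vanishing on the far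
ray of the cone. On every other cone at least one of the two determinants is nonpositive, so the
truncation at `0` takes effect. -/
theorem fanCoord_cone (hn : 4 ≤ n) (m k : ZMod n) {a b : ℝ} (ha : 0 ≤ a) (hb : 0 ≤ b) :
    fanCoord k (a * fanRay m + b * fanRay (m + 1)) =
      if k = m then a else if k = m + 1 then b else 0 := by
  have hS := fanRay_one_im_pos (n := n) (by omega)
  obtain ⟨d, hd, rfl⟩ : ∃ d : ℕ, d < n ∧ k = m + (d : ZMod n) :=
    ⟨(k - m).val, ZMod.val_lt _, by simp⟩
  have e1 : planeCross (a * fanRay m + b * fanRay (m + 1)) (fanRay (m + (d : ZMod n) + 1)) =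
      a * (fanRay ((d + 1 : ℤ) : ZMod n)).im + b * (fanRay ((d : ℤ) : ZMod n)).im := by
    have h1 := planeCross_fanRay m (m + (d : ZMod n) + 1)
    have h2 := planeCross_fanRay (m + 1) (m + (d : ZMod n) + 1)
    rw [show m + (d : ZMod n) + 1 - m = ((d + 1 : ℤ) : ZMod n) by push_cast; ring] at h1
    rw [show m + (d : ZMod n) + 1 - (m + 1) = ((d : ℤ) : ZMod n) by push_cast; ring] at h2
    rw [← h1, ← h2]
    simp [planeCross]
    ring
  have e2 : planeCross (fanRay (m + (d : ZMod n) - 1)) (a * fanRay m + b * fanRay (m + 1)) =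
      -(a * (fanRay ((d - 1 : ℤ) : ZMod n)).im) - b * (fanRay ((d - 2 : ℤ) : ZMod n)).im := by
    have h1 := planeCross_fanRay (m + (d : ZMod n) - 1) m
    have h2 := planeCross_fanRay (m + (d : ZMod n) - 1) (m + 1)
    rw [show m - (m + (d : ZMod n) - 1) = -((d - 1 : ℤ) : ZMod n) by push_cast; ring,
      fanRay_neg_im] at h1
    rw [show m + 1 - (m + (d : ZMod n) - 1) = -((d - 2 : ℤ) : ZMod n) by push_cast; ring,
      fanRay_neg_im] at h2
    have h3 : planeCross (fanRay (m + (d : ZMod n) - 1)) (a * fanRay m + b * fanRay (m + 1)) =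
        a * planeCross (fanRay (m + (d : ZMod n) - 1)) (fanRay m) +
          b * planeCross (fanRay (m + (d : ZMod n) - 1)) (fanRay (m + 1)) := by
      simp [planeCross]
      ring
    rw [h3, h1, h2]
    ring
  have hz : fanRay (0 : ZMod n) = 1 := by simp [fanRay]
  -- This is where `n ≥ 4` enters: two successive sectors span at most a half turn, so the minimum
  -- selects the intended determinant when `d` is `0` or `1`.
  have h2 : 0 ≤ (fanRay (2 : ZMod n)).im := by
    simpa using fanRay_im_nonneg (n := n) (j := 2) (by norm_num) (by omega)
  have hm1 : (fanRay (-1 : ZMod n)).im = - (fanRay (1 : ZMod n)).im := fanRay_neg_im 1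
  have hm2 : (fanRay (-2 : ZMod n)).im = - (fanRay (2 : ZMod n)).im := fanRay_neg_im 2
  rw [fanCoord, e1, e2, div_eq_iff hS.ne']
  rcases Nat.lt_or_ge d 2 with h | h
  · interval_cases d
    · norm_num [hz, hm1, hm2]
      rw [min_eq_left (by nlinarith [mul_nonneg hb h2]), max_eq_right (by positivity)]
    · have : (1 : ZMod n) ≠ 0 := by
        have : Fact (1 < n) := ⟨by omega⟩
        exact one_ne_zero
      norm_num [hz, hm1, this]
      rw [min_eq_right (by nlinarith [mul_nonneg ha h2]), max_eq_right (by positivity)]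
  · have hne : ∀ c : ℕ, c < 2 → (d : ZMod n) ≠ c := by
      intro c hc he
      rw [ZMod.natCast_eq_natCast_iff'] at he
      rw [Nat.mod_eq_of_lt hd, Nat.mod_eq_of_lt (by omega)] at he
      omega
    have h0 : (d : ZMod n) ≠ 0 := by simpa using hne 0 (by norm_num)
    have h1 : (d : ZMod n) ≠ 1 := by simpa using hne 1 (by norm_num)
    rw [if_neg (by simpa using h0), if_neg (by simpa using h1), zero_mul]
    apply max_eq_left
    -- If ray `k - 1` is at most a half turn ahead of ray `m`, the cone lies clockwise of ray `k -
    -- 1`; otherwise it lies counterclockwise of ray `k + 1`.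
    rcases le_total (2 * ((d : ℤ) - 1)) n with h3 | h3
    · apply (min_le_right _ _).trans
      have := fanRay_im_nonneg (n := n) (j := d - 1) (by omega) (by omega)
      have := fanRay_im_nonneg (n := n) (j := d - 2) (by omega) (by omega)
      nlinarith [mul_nonneg ha ‹0 ≤ (fanRay ((d - 1 : ℤ) : ZMod n)).im›,
        mul_nonneg hb ‹0 ≤ (fanRay ((d - 2 : ℤ) : ZMod n)).im›]
    · apply (min_le_left _ _).trans
      have h4 := fanRay_im_nonpos (n := n) (j := d + 1) (by omega) (by omega)
      have h5 := fanRay_im_nonpos (n := n) (j := d) (by omega) (by omega)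
      nlinarith [mul_nonneg ha (neg_nonneg.2 h4), mul_nonneg hb (neg_nonneg.2 h5)]

/-- The sector is found by rounding down `arg w / θ`, where `θ` is the angle of a sector; the
coefficients come from the law of sines. -/
theorem exists_cone (hn : 3 ≤ n) (w : ℂ) : ∃ (m : ZMod n) (a b : ℝ), 0 ≤ a ∧ 0 ≤ b ∧
    w = a * fanRay m + b * fanRay (m + 1) := by
  have hS := fanRay_one_im_pos hn
  have hn' : (3 : ℝ) ≤ n := by exact_mod_cast hn
  set θ : ℝ := 2 * Real.pi / n with hθ
  have hθ0 : 0 < θ := by have := Real.pi_pos; positivity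
  have hθ1 : θ ≤ Real.pi := by
    rw [hθ, div_le_iff₀ (by linarith)]
    nlinarith [Real.pi_pos]
  set m : ℤ := ⌊arg w / θ⌋ with hm
  have h1 : m * θ ≤ arg w := (le_div_iff₀ hθ0).1 (Int.floor_le _)
  have h2 : arg w < (m + 1) * θ := (div_lt_iff₀ hθ0).1 (Int.lt_floor_add_one _)
  have hS1 : (fanRay (1 : ZMod n)).im = Real.sin θ := by
    simpa using fanRay_intCast_im (n := n) 1
  rw [hS1] at hS
  refine ⟨(m : ZMod n), ‖w‖ * Real.sin ((m + 1) * θ - arg w) / Real.sin θ,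
    ‖w‖ * Real.sin (arg w - m * θ) / Real.sin θ, ?_, ?_, ?_⟩
  · have := Real.sin_nonneg_of_nonneg_of_le_pi (x := (m + 1) * θ - arg w) (by linarith)
      (by linarith)
    positivity
  · have := Real.sin_nonneg_of_nonneg_of_le_pi (x := arg w - m * θ) (by linarith) (by linarith)
    positivity
  · have hre : w.re = ‖w‖ * Real.cos (arg w) := (norm_mul_cos_arg w).symm
    have him : w.im = ‖w‖ * Real.sin (arg w) := (norm_mul_sin_arg w).symm
    have hsq := Real.sin_sq_add_cos_sq (m * θ)
    have hc2 := fanRay_intCast_re (n := n) m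
    have hs2 := fanRay_intCast_im (n := n) m
    have hc3 := fanRay_intCast_re (n := n) (m + 1)
    have hs3 := fanRay_intCast_im (n := n) (m + 1)
    rw [← hθ] at hc2 hs2 hc3 hs3
    push_cast at hc3 hs3
    rw [add_mul, one_mul, Real.cos_add] at hc3
    rw [add_mul, one_mul, Real.sin_add] at hs3
    apply Complex.ext
    · rw [add_re, re_ofReal_mul, re_ofReal_mul, hc2]
      rw [hc3, hre, add_mul, one_mul, Real.sin_sub, Real.sin_sub, Real.sin_add, Real.cos_add]
      field_simp
      linear_combination (-‖w‖ * Real.sin θ * Real.cos (arg w)) * hsq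
    · rw [add_im, im_ofReal_mul, im_ofReal_mul, hs2]
      rw [hs3, him, add_mul, one_mul, Real.sin_sub, Real.sin_sub, Real.sin_add, Real.cos_add]
      field_simp
      linear_combination (-‖w‖ * Real.sin θ * Real.sin (arg w)) * hsq

end Fan

theorem ZMod.ne_add_one {n : ℕ} (hn : 4 ≤ n) (m : ZMod n) : m ≠ m + 1 := by
  have : Fact (1 < n) := ⟨by omega⟩
  simp

/-! ### Planar charts on open stars -/

namespace PreAbstractSimplicialComplex

section Star

open Classical

variable {V : Type*} {n : ℕ}

/-- The point with barycentric coordinates proportional to `1, a, b` at the vertices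
`v, l m, l (m + 1)`. -/
noncomputable def conePoint (v : V) (l : ZMod n → V) (m : ZMod n) (a b : ℝ) (u : V) : ℝ :=
  (if u = v then 1 else if u = l m then a else if u = l (m + 1) then b else 0) / (1 + a + b)

/-- The link of `v` in `K` is the `n`-gon with the successive vertices `l k`. -/
structure IsCyclicLink (K : PreAbstractSimplicialComplex V) (v : V) (l : ZMod n → V) : Prop where
  inj : Function.Injective l
  ne : ∀ k, l k ≠ v
  mem_faces : ∀ s : Finset V, v ∈ s →
    (s ∈ K.faces ↔ ∃ m, ∀ u ∈ s, u = v ∨ u = l m ∨ u = l (m + 1))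

variable {K : PreAbstractSimplicialComplex V} {v : V} {l : ZMod n → V}

namespace IsCyclicLink

theorem conePoint_mem (h : K.IsCyclicLink v l) (hn : 4 ≤ n) (m : ZMod n) {a b : ℝ} (ha : 0 ≤ a)
    (hb : 0 ≤ b) : (∀ u, 0 ≤ conePoint v l m a b u) ∧ ∃ s ∈ K.faces,
      (∀ u, u ∉ s → conePoint v l m a b u = 0) ∧ ∑ u ∈ s, conePoint v l m a b u = 1 := by
  have hne : l m ≠ l (m + 1) := fun e => ZMod.ne_add_one hn m (h.inj e)
  refine ⟨fun u => ?_, {v, l m, l (m + 1)}, (h.mem_faces _ (by simp)).2 ⟨m, by simp⟩, ?_, ?_⟩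
  · unfold conePoint
    split_ifs <;> positivity
  · intro u hu
    simp only [Finset.mem_insert, Finset.mem_singleton, not_or] at hu
    simp [conePoint, hu]
  · rw [Finset.sum_insert (by simp [(h.ne _).symm]), Finset.sum_pair hne]
    simp only [conePoint, h.ne, hne.symm, if_true, if_false]
    field_simp
    ring

/-- Dividing by the positive coordinate at `v` turns barycentric coordinates into cone coordinates.
-/
theorem exists_eq_conePoint (h : K.IsCyclicLink v l) (hn : 4 ≤ n) (t : K.Realization)
    (ht : 0 < t.1 v) : ∃ (m : ZMod n) (a b : ℝ), 0 ≤ a ∧ 0 ≤ b ∧ t.1 = conePoint v l m a b := by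
  obtain ⟨t, h0, s, hs, hzero, hsum⟩ := t
  change 0 < t v at ht
  have hvs : v ∈ s := by
    by_contra hv
    exact ht.ne' (hzero v hv)
  obtain ⟨m, hm⟩ := (h.mem_faces s hvs).1 hs
  have hne : l m ≠ l (m + 1) := fun e => ZMod.ne_add_one hn m (h.inj e)
  have hsub : s ⊆ {v, l m, l (m + 1)} := fun u hu => by simpa using hm u hu
  rw [Finset.sum_subset hsub fun u _ hu => hzero u hu,
    Finset.sum_insert (by simp [(h.ne _).symm]), Finset.sum_pair hne] at hsum
  refine ⟨m, t (l m) / t v, t (l (m + 1)) / t v, div_nonneg (h0 _) ht.le,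
    div_nonneg (h0 _) ht.le, ?_⟩
  have hden : 1 + t (l m) / t v + t (l (m + 1)) / t v = 1 / t v := by
    field_simp
    linarith
  funext u
  change t u = _
  rw [conePoint, hden]
  split_ifs with h1 h2 h3
  · subst h1; field_simp
  · subst h2; field_simp
  · subst h3; field_simp
  · rw [zero_div]
    apply hzero
    intro hu
    rcases hm u hu with h' | h' | h' <;> contradiction

variable [NeZero n]

/-- The coordinate map on the open star. -/
noncomputable def starMap (v : V) (l : ZMod n → V) (t : V → ℝ) : ℂ :=
  ∑ k : ZMod n, ((t (l k) / t v : ℝ) : ℂ) * fanRay k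

/-- The inverse of the coordinate map on the open star. -/
noncomputable def starInv (v : V) (l : ZMod n → V) (w : ℂ) (u : V) : ℝ :=
  (if u = v then 1 else ∑ k : ZMod n, if u = l k then fanCoord k w else 0) /
    (1 + ∑ k : ZMod n, fanCoord k w)

theorem starMap_conePoint (h : K.IsCyclicLink v l) (hn : 4 ≤ n) (m : ZMod n) {a b : ℝ}
    (ha : 0 ≤ a) (hb : 0 ≤ b) :
    starMap v l (conePoint v l m a b) = a * fanRay m + b * fanRay (m + 1) := by
  have hpos : 0 < 1 + a + b := by positivity
  have hmm := ZMod.ne_add_one hn m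
  rw [starMap, Fintype.sum_eq_add m (m + 1) hmm]
  · simp only [conePoint, h.ne, h.inj.ne hmm.symm, if_true, if_false]
    congr 3 <;> field_simp
  · intro k hk
    simp [conePoint, h.ne, h.inj.ne hk.1, h.inj.ne hk.2]

/-- Only `fanCoord m` and `fanCoord (m + 1)` can be nonzero on this cone. Hence the inverse, which
is naturally defined cone by cone, has one global formula whose continuity is clear, and no gluing
along the rays is needed. -/
theorem starInv_cone (h : K.IsCyclicLink v l) (hn : 4 ≤ n) (m : ZMod n) {a b : ℝ}
    (ha : 0 ≤ a) (hb : 0 ≤ b) :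
    starInv v l (a * fanRay m + b * fanRay (m + 1)) = conePoint v l m a b := by
  have hmm := ZMod.ne_add_one hn m
  funext u
  have hsum : ∑ k : ZMod n, fanCoord k (a * fanRay m + b * fanRay (m + 1)) = a + b := by
    simp only [fanCoord_cone hn m _ ha hb]
    rw [Fintype.sum_eq_add m (m + 1) hmm]
    · simp [hmm.symm]
    · intro k hk
      simp [hk.1, hk.2]
  rw [starInv, conePoint, hsum, add_assoc]
  congr 1
  split_ifs with h1 h2 h3
  · rfl
  · rw [Fintype.sum_eq_single m]
    · rw [if_pos h2, fanCoord_cone hn m _ ha hb, if_pos rfl]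
    · intro k hk
      rw [if_neg (h2 ▸ h.inj.ne hk.symm)]
  · rw [Fintype.sum_eq_single (m + 1)]
    · rw [if_pos h3, fanCoord_cone hn m _ ha hb, if_neg hmm.symm, if_pos rfl]
    · intro k hk
      rw [if_neg (h3 ▸ h.inj.ne hk.symm)]
  · apply Finset.sum_eq_zero
    intro k _
    rw [fanCoord_cone hn m _ ha hb]
    split_ifs <;> simp_all

theorem fanCoord_nonneg (hn : 4 ≤ n) (k : ZMod n) (w : ℂ) : 0 ≤ fanCoord k w :=
  div_nonneg (le_max_left _ _) (fanRay_one_im_pos (by omega)).le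

/-- The open star of a vertex whose link is a polygon is homeomorphic to the plane. -/
theorem exists_openPartialHomeomorph (h : K.IsCyclicLink v l) (hn : 4 ≤ n) :
    ∃ e : OpenPartialHomeomorph K.Realization ℂ, e.source = {t | 0 < t.1 v} := by
  have hcoord : ∀ u : V, Continuous fun t : K.Realization => t.1 u := fun u =>
    (continuous_apply u).comp continuous_subtype_val
  have hinv : ∀ w, (∀ u, 0 ≤ starInv v l w u) ∧ ∃ s ∈ K.faces,
      (∀ u, u ∉ s → starInv v l w u = 0) ∧ ∑ u ∈ s, starInv v l w u = 1 := by
    intro w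
    obtain ⟨m, a, b, ha, hb, rfl⟩ := exists_cone (n := n) (by omega) w
    rw [h.starInv_cone hn m ha hb]
    exact h.conePoint_mem hn m ha hb
  refine ⟨{
    toFun := fun t => starMap v l t.1
    invFun := fun w => ⟨starInv v l w, hinv w⟩
    source := {t | 0 < t.1 v}
    target := Set.univ
    map_source' := fun _ _ => Set.mem_univ _
    map_target' := ?_
    left_inv' := ?_
    right_inv' := ?_
    open_source := isOpen_lt continuous_const (hcoord v)
    open_target := isOpen_univ
    continuousOn_toFun := ?_
    continuousOn_invFun := ?_ }, rfl⟩
  · intro w _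
    have : 0 ≤ ∑ k : ZMod n, fanCoord k w := Finset.sum_nonneg fun k _ => fanCoord_nonneg hn k w
    change 0 < starInv v l w v
    rw [starInv, if_pos rfl]
    positivity
  · intro t ht
    obtain ⟨m, a, b, ha, hb, e⟩ := h.exists_eq_conePoint hn t ht
    apply Subtype.ext
    change starInv v l (starMap v l t.1) = t.1
    rw [e, h.starMap_conePoint hn m ha hb, h.starInv_cone hn m ha hb]
  · intro w _
    obtain ⟨m, a, b, ha, hb, rfl⟩ := exists_cone (n := n) (by omega) w
    change starMap v l (starInv v l _) = _
    rw [h.starInv_cone hn m ha hb, h.starMap_conePoint hn m ha hb]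
  · unfold starMap
    refine continuousOn_finsetSum _ fun k _ => ContinuousOn.mul ?_ continuousOn_const
    refine Complex.continuous_ofReal.comp_continuousOn ?_
    exact (hcoord _).continuousOn.div (hcoord _).continuousOn fun t ht => ne_of_gt ht
  · apply Continuous.continuousOn
    refine Continuous.subtype_mk (continuous_pi fun u => ?_) _
    unfold starInv
    refine Continuous.div ?_ ?_ ?_
    · split_ifs
      · exact continuous_const
      · refine continuous_finsetSum _ fun k _ => ?_
        split_ifs
        · exact continuous_fanCoord k
        · exact continuous_const
    · exact Continuous.add continuous_const
        (continuous_finsetSum _ fun k _ => continuous_fanCoord k)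
    · intro w
      have : 0 ≤ ∑ k : ZMod n, fanCoord k w :=
        Finset.sum_nonneg fun k _ => fanCoord_nonneg hn k w
      positivity

end IsCyclicLink

/-- A complex in which all links of vertices are polygons is a surface. -/
theorem nonempty_chartedSpace [NeZero n] (hn : 4 ≤ n)
    (h : ∀ v, {v} ∈ K.faces → ∃ l : ZMod n → V, K.IsCyclicLink v l) :
    Nonempty (ChartedSpace (EuclideanSpace ℝ (Fin 2)) K.Realization) := by
  have hex : ∀ t : K.Realization, ∃ e : OpenPartialHomeomorph K.Realization ℂ, t ∈ e.source := by
    intro t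
    obtain ⟨h0, s, hs, hzero, hsum⟩ := t.2
    -- The coordinates sum to `1`, so some vertex has a positive one: the open stars cover the
    -- realization.
    obtain ⟨v, hv, hpos⟩ : ∃ v ∈ s, 0 < t.1 v := by
      by_contra! hcon
      have : ∑ v ∈ s, t.1 v ≤ 0 := Finset.sum_nonpos hcon
      linarith
    obtain ⟨l, hl⟩ := h v ((K.isRelLowerSet_faces hs).2 (by simpa using hv) (by simp))
    obtain ⟨e, he⟩ := hl.exists_openPartialHomeomorph hn
    exact ⟨e, he ▸ hpos⟩
  choose e he using hex
  let φ : ℂ ≃ₜ EuclideanSpace ℝ (Fin 2) := Complex.orthonormalBasisOneI.repr.toHomeomorph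
  exact ⟨{
    atlas := Set.range fun t => (e t).transHomeomorph φ
    chartAt := fun t => (e t).transHomeomorph φ
    mem_chart_source := fun t => by simpa using he t
    chart_mem_atlas := fun t => Set.mem_range_self t }⟩

end Star

end PreAbstractSimplicialComplex

/-! ### The tripartite model: links and orientation -/

namespace PreAbstractSimplicialComplex

section Tripartite

variable {V : Type*} {p : ℕ}

/-- The vertices of `K` are `f c i`, of colour `c : Fin 3` and index `i : ZMod p`, and its triangles
are `{f 0 i, f 1 j, f 2 k}` with `i + j + k = 0` or `i + j + k = 1`. -/
structure IsTripartiteModel (K : PreAbstractSimplicialComplex V) (f : Fin 3 → ZMod p → V) :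
    Prop where
  inj : ∀ c d i j, f c i = f d j → c = d ∧ i = j
  mem_faces : ∀ s, s ∈ K.faces ↔ s.Nonempty ∧ ∃ x y z : ZMod p,
    (x + y + z = 0 ∨ x + y + z = 1) ∧ ∀ v ∈ s, v = f 0 x ∨ v = f 1 y ∨ v = f 2 z

namespace IsTripartiteModel

variable {K : PreAbstractSimplicialComplex V} {f : Fin 3 → ZMod p → V}

/-- The condition on the sum is symmetric in the colours, so the link of a vertex can be studied for
all three colours at once. -/
theorem mem_faces_rotate (h : K.IsTripartiteModel f) (c : Fin 3) (s : Finset V) :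
    s ∈ K.faces ↔ s.Nonempty ∧ ∃ x y z : ZMod p, (x + y + z = 0 ∨ x + y + z = 1) ∧
      ∀ v ∈ s, v = f c x ∨ v = f (c + 1) y ∨ v = f (c + 2) z := by
  rw [h.mem_faces]
  refine and_congr_right fun _ => ?_
  fin_cases c
  · rfl
  · constructor
    · rintro ⟨x, y, z, hs, hv⟩
      refine ⟨y, z, x, by rwa [show y + z + x = x + y + z by ring], fun v hvs => ?_⟩
      rcases hv v hvs with h | h | h <;> simp [h]
    · rintro ⟨x, y, z, hs, hv⟩
      refine ⟨z, x, y, by rwa [show z + x + y = x + y + z by ring], fun v hvs => ?_⟩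
      rcases hv v hvs with h | h | h
      · exact .inr (.inl h)
      · exact .inr (.inr h)
      · exact .inl h
  · constructor
    · rintro ⟨x, y, z, hs, hv⟩
      refine ⟨z, x, y, by rwa [show z + x + y = x + y + z by ring], fun v hvs => ?_⟩
      rcases hv v hvs with h | h | h <;> simp [h]
    · rintro ⟨x, y, z, hs, hv⟩
      refine ⟨y, z, x, by rwa [show y + z + x = x + y + z by ring], fun v hvs => ?_⟩
      rcases hv v hvs with h | h | h
      · exact .inr (.inr h)
      · exact .inl h
      · exact .inr (.inl h)

theorem ne_of_color_ne (h : K.IsTripartiteModel f) {c d : Fin 3} (hcd : c ≠ d) (i j : ZMod p) :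
    f c i ≠ f d j := fun e => hcd (h.inj _ _ _ _ e).1

theorem eq_iff (h : K.IsTripartiteModel f) {c d : Fin 3} {i j : ZMod p} :
    f c i = f d j ↔ c = d ∧ i = j :=
  ⟨h.inj c d i j, fun e => by rw [e.1, e.2]⟩

/-- Every vertex of `K` has the form `f c i`. -/
theorem exists_of_mem (h : K.IsTripartiteModel f) {s : Finset V} (hs : s ∈ K.faces) {v : V}
    (hv : v ∈ s) : ∃ c i, v = f c i := by
  obtain ⟨-, x, y, z, -, hsub⟩ := (h.mem_faces s).1 hs
  rcases hsub v hv with e | e | e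
  exacts [⟨_, _, e⟩, ⟨_, _, e⟩, ⟨_, _, e⟩]

open Classical in
/-- The vertex set `{f 0 x, f 1 y, f 2 z}`. -/
noncomputable def triangleOf (f : Fin 3 → ZMod p → V) (x y z : ZMod p) : Finset V :=
  {f 0 x, f 1 y, f 2 z}

@[simp]
theorem mem_triangleOf {x y z : ZMod p} {v : V} :
    v ∈ triangleOf f x y z ↔ v = f 0 x ∨ v = f 1 y ∨ v = f 2 z := by
  simp [triangleOf]

theorem mem_faces_iff_subset (h : K.IsTripartiteModel f) {s : Finset V} :
    s ∈ K.faces ↔ s.Nonempty ∧ ∃ x y z : ZMod p, (x + y + z = 0 ∨ x + y + z = 1) ∧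
      s ⊆ triangleOf f x y z := by
  simp only [h.mem_faces, Finset.subset_iff, mem_triangleOf]

open Classical in
theorem card_triangleOf (h : K.IsTripartiteModel f) (x y z : ZMod p) :
    (triangleOf f x y z).card = 3 := by
  rw [triangleOf, Finset.card_eq_three]
  exact ⟨_, _, _, h.ne_of_color_ne (by decide) _ _, h.ne_of_color_ne (by decide) _ _,
    h.ne_of_color_ne (by decide) _ _, rfl⟩

theorem triangleOf_mem (h : K.IsTripartiteModel f) {x y z : ZMod p}
    (hs : x + y + z = 0 ∨ x + y + z = 1) : triangleOf f x y z ∈ K.faces :=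
  h.mem_faces_iff_subset.2 ⟨⟨f 0 x, by simp⟩, x, y, z, hs, subset_rfl⟩

/-- Colours and indices can be read off from the vertices. -/
theorem exists_leftInverse (h : K.IsTripartiteModel f) :
    ∃ (col : V → Fin 3) (idx : V → ZMod p), ∀ c i, col (f c i) = c ∧ idx (f c i) = i := by
  have hinj : Function.Injective fun q : Fin 3 × ZMod p => f q.1 q.2 := fun q q' e =>
    Prod.ext (h.inj _ _ _ _ e).1 (h.inj _ _ _ _ e).2
  refine ⟨fun v => (Function.invFun (fun q : Fin 3 × ZMod p => f q.1 q.2) v).1,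
    fun v => (Function.invFun (fun q : Fin 3 × ZMod p => f q.1 q.2) v).2, fun c i => ?_⟩
  have := Function.leftInverse_invFun hinj (c, i)
  exact ⟨congrArg Prod.fst this, congrArg Prod.snd this⟩

variable [Fact p.Prime]

theorem half_add_half (hp : Odd p) : (2 : ZMod p)⁻¹ + (2 : ZMod p)⁻¹ = 1 := by
  have h2 : (2 : ZMod p) ≠ 0 := by
    intro h
    have : ((2 : ℕ) : ZMod p) = 0 := by exact_mod_cast h
    rw [ZMod.natCast_eq_zero_iff, Nat.prime_dvd_prime_iff_eq Fact.out Nat.prime_two] at this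
    subst this
    exact absurd hp (by decide)
  rw [← two_mul, mul_inv_cancel₀ h2]

/-- The link of the vertex `f c x` is a `2p`-gon. -/
theorem exists_isCyclicLink (h : K.IsTripartiteModel f) (hp : Odd p) (c : Fin 3) (x : ZMod p) :
    ∃ l : ZMod (2 * p) → V, K.IsCyclicLink (f c x) l := by
  have hcop : Nat.Coprime 2 p := (Nat.coprime_two_left).2 hp
  let crt := ZMod.chineseRemainder hcop
  set t : ZMod p := (2 : ZMod p)⁻¹ with ht
  have htt : t + t = 1 := half_add_half hp
  have ht0 : t ≠ 0 := by
    intro h0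
    rw [h0] at htt
    simp at htt
  have h01 : ∀ e : ZMod 2, e = 0 ∨ e = 1 := by decide
  have h10 : (1 : ZMod 2) ≠ 0 := by decide
  have h11 : (1 : ZMod 2) + 1 = 0 := by decide
  have c1 : c ≠ c + 1 := by revert c; decide
  have c2 : c ≠ c + 2 := by revert c; decide
  have c3 : c + 1 ≠ c + 2 := by revert c; decide
  -- Around `f c x`, sums `0` and `1` alternate: `y` is followed by `-x - y`, then by `y + 1`. Thus
  -- two steps raise the index of colour `c + 1` by one, and one step should raise it by `t = 1/2`.
  -- The Chinese remainder theorem splits the position into a parity, which gives the colour, and a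
  -- residue mod `p`, which gives the index.
  let l : ZMod (2 * p) → V := fun m =>
    if (crt m).1 = 0 then f (c + 1) (t * (crt m).2) else f (c + 2) (t - x - t * (crt m).2)
  have l0 : ∀ m, (crt m).1 = 0 → l m = f (c + 1) (t * (crt m).2) := fun m hm => if_pos hm
  have l1 : ∀ m, (crt m).1 = 1 → l m = f (c + 2) (t - x - t * (crt m).2) := fun m hm =>
    if_neg (by rw [hm]; exact h10)
  have s2 : ∀ m, (crt (m + 1)).2 = (crt m).2 + 1 := fun m => by simp
  refine ⟨l, ⟨?_, ?_, ?_⟩⟩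
  · intro m m' e
    apply crt.injective
    rcases h01 (crt m).1 with hm | hm <;> rcases h01 (crt m').1 with hm' | hm'
    · rw [l0 m hm, l0 m' hm'] at e
      exact Prod.ext (by rw [hm, hm']) (mul_left_cancel₀ ht0 (h.inj _ _ _ _ e).2)
    · rw [l0 m hm, l1 m' hm'] at e
      exact absurd e (h.ne_of_color_ne c3 _ _)
    · rw [l1 m hm, l0 m' hm'] at e
      exact absurd e (h.ne_of_color_ne c3.symm _ _)
    · rw [l1 m hm, l1 m' hm'] at e
      exact Prod.ext (by rw [hm, hm'])
        (mul_left_cancel₀ ht0 (sub_right_injective (h.inj _ _ _ _ e).2))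
  · intro m
    rcases h01 (crt m).1 with hm | hm
    · rw [l0 m hm]
      exact h.ne_of_color_ne c1.symm _ _
    · rw [l1 m hm]
      exact h.ne_of_color_ne c2.symm _ _
  · intro s hs
    rw [h.mem_faces_rotate c, and_iff_right ⟨_, hs⟩]
    constructor
    · rintro ⟨x', y, z, hsum, hv⟩
      obtain rfl : x = x' := by
        rcases hv _ hs with e | e | e
        · exact (h.inj _ _ _ _ e).2
        · exact absurd e (h.ne_of_color_ne c1 _ _)
        · exact absurd e (h.ne_of_color_ne c2 _ _)
      rcases hsum with hsum | hsum
      -- Sum `0` occurs on the step from an even to an odd position, sum `1` on the step from an odd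
      -- to an even one. The residue is obtained by solving the formula of `l` for `m`, which undoes
      -- the factor `1/2`.
      · refine ⟨crt.symm (0, y + y), fun u hu => ?_⟩
        rw [l0 _ (by simp), l1 _ (by simp), s2]
        simp only [RingEquiv.apply_symm_apply]
        rw [show t * (y + y) = y by linear_combination y * htt,
          show t - x - t * (y + y + 1) = z by linear_combination -y * htt - hsum]
        exact hv u hu
      · refine ⟨crt.symm (1, 1 - x - x - z - z), fun u hu => ?_⟩
        rw [l1 _ (by simp), l0 _ (by simp [h11]), s2]
        simp only [RingEquiv.apply_symm_apply]
        rw [show t - x - t * (1 - x - x - z - z) = z by linear_combination (x + z) * htt,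
          show t * (1 - x - x - z - z + 1) = y by linear_combination (1 - x - z) * htt - hsum]
        rcases hv u hu with e | e | e <;> simp [e]
    · rintro ⟨m, hm⟩
      rcases h01 (crt m).1 with hm1 | hm1
      · refine ⟨x, t * (crt m).2, t - x - t * (crt (m + 1)).2, ?_, fun u hu =>
          (hm u hu).imp_right ?_⟩
        rotate_left
        · rw [l0 m hm1, l1 (m + 1) (by simp [hm1])]
          exact id
        · left
          rw [s2]
          ring
      · refine ⟨x, t * (crt (m + 1)).2, t - x - t * (crt m).2, ?_, fun u hu =>
          (hm u hu).imp_right ?_⟩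
        rotate_left
        · rw [l1 m hm1, l0 (m + 1) (by simp [hm1, h11]), or_comm]
          exact id
        · right
          rw [s2]
          linear_combination htt

theorem nonempty_chartedSpace (h : K.IsTripartiteModel f) (hp : Odd p) :
    Nonempty (ChartedSpace (EuclideanSpace ℝ (Fin 2)) K.Realization) := by
  have hp2 := (Fact.out : p.Prime).two_le
  have : NeZero (2 * p) := ⟨by omega⟩
  refine PreAbstractSimplicialComplex.nonempty_chartedSpace (n := 2 * p) (by omega) fun v hv => ?_
  obtain ⟨c, i, rfl⟩ := h.exists_of_mem hv (Finset.mem_singleton_self v)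
  exact h.exists_isCyclicLink hp c i

theorem isTriangle_colors (h : K.IsTripartiteModel f) {col : V → Fin 3} {idx : V → ZMod p}
    (hci : ∀ c i, col (f c i) = c ∧ idx (f c i) = i) {a b c : V} (ht : K.IsTriangle a b c) :
    (col a ≠ col b ∧ col b ≠ col c ∧ col a ≠ col c) ∧
    (idx a + idx b + idx c = 0 ∨ idx a + idx b + idx c = 1) ∧ c = f (col c) (idx c) := by
  obtain ⟨hab, hbc, hac, s, hs, hsc⟩ := ht
  obtain ⟨-, x, y, z, hsum, hv⟩ := (h.mem_faces s).1 hs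
  have ha := hv a (by rw [← Finset.mem_coe, hsc]; simp)
  have hb := hv b (by rw [← Finset.mem_coe, hsc]; simp)
  have hc := hv c (by rw [← Finset.mem_coe, hsc]; simp)
  have h1 : ∀ c i, col (f c i) = c := fun c i => (hci c i).1
  have h2 : ∀ c i, idx (f c i) = i := fun c i => (hci c i).2
  have e1 : x + z + y = x + y + z := by ring
  have e2 : y + x + z = x + y + z := by ring
  have e3 : y + z + x = x + y + z := by ring
  have e4 : z + x + y = x + y + z := by ring
  have e5 : z + y + x = x + y + z := by ring
  rcases ha with rfl | rfl | rfl <;> rcases hb with rfl | rfl | rfl <;>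
    first
    | exact absurd rfl hab
    | (rcases hc with rfl | rfl | rfl <;>
        first
        | exact absurd rfl hbc
        | exact absurd rfl hac
        | (simp only [h1, h2, e1, e2, e3, e4, e5]
           exact ⟨by decide, hsum, trivial⟩))

theorem orientable (h : K.IsTripartiteModel f) : K.Orientable := by
  obtain ⟨col, idx, hci⟩ := h.exists_leftInverse
  have h01 : (0 : ZMod p) ≠ 1 := zero_ne_one
  have k1 : ∀ a b c : Fin 3, a ≠ b → b ≠ c → a ≠ c →
      ((c = b + 1 ∧ a = c + 1) ↔ (b = a + 1 ∧ c = b + 1)) := by decide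
  have k2 : ∀ a b c : Fin 3, a ≠ b → b ≠ c → a ≠ c →
      ((b = a + 2 ∧ c = b + 2) ↔ ¬ (b = a + 1 ∧ c = b + 1)) := by decide
  have k3 : ∀ a b c : Fin 3, a ≠ b → b ≠ c → a ≠ c →
      ((c = b + 2 ∧ a = c + 2) ↔ ¬ (b = a + 1 ∧ c = b + 1)) := by decide
  have k4 : ∀ a b c : Fin 3, a ≠ b → b ≠ c → a ≠ c →
      ((a = b + 1 ∧ c = a + 1) ↔ ¬ (b = a + 1 ∧ c = b + 1)) := by decide
  have k5 : ∀ a b c : Fin 3, a ≠ b → b ≠ c → a ≠ c →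
      ((a = b + 2 ∧ c = a + 2) ↔ (b = a + 1 ∧ c = b + 1)) := by decide
  -- Triangles of sum `0` carry the cyclic order of the colours, triangles of sum `1` the opposite
  -- one.
  refine ⟨fun a b c => (idx a + idx b + idx c = 0 ∧ col b = col a + 1 ∧ col c = col b + 1) ∨
    (idx a + idx b + idx c = 1 ∧ col b = col a + 2 ∧ col c = col b + 2), ?_, ?_⟩
  · intro a b c ht
    obtain ⟨⟨hab, hbc, hac⟩, hsum, -⟩ := h.isTriangle_colors hci ht
    have e1 : idx b + idx c + idx a = idx a + idx b + idx c := by ring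
    have e2 : idx b + idx a + idx c = idx a + idx b + idx c := by ring
    beta_reduce
    rw [e1, e2, k1 _ _ _ hab hbc hac, k2 _ _ _ hab hbc hac, k3 _ _ _ hab hbc hac,
      k4 _ _ _ hab hbc hac, k5 _ _ _ hab hbc hac]
    rcases hsum with hsum | hsum <;> rw [hsum] <;> simp only [h01, h01.symm, true_and, false_and,
      or_false, false_or] <;> tauto
  · intro a b c d ht ht' hcd
    obtain ⟨⟨hab, hbc, hac⟩, hsum, hc⟩ := h.isTriangle_colors hci ht
    obtain ⟨⟨-, hbd, had⟩, hsum', hd⟩ := h.isTriangle_colors hci ht'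
    -- Both `c` and `d` have the colour missing on the common edge. Being distinct, they differ in
    -- their index, so the two sums differ and the orientations cancel.
    have hcol : col c = col d := by
      revert hab hbc hac hbd had
      generalize col a = a', col b = b', col c = c', col d = d'
      revert a' b' c' d'
      decide
    have hidx : idx c ≠ idx d := fun e => hcd (by rw [hc, hd, hcol, e])
    have e2 : idx b + idx a + idx d = idx a + idx b + idx d := by ring
    beta_reduce
    rw [e2, ← hcol, k2 _ _ _ hab hbc hac, k4 _ _ _ hab hbc hac, k5 _ _ _ hab hbc hac]
    rcases hsum with hsum | hsum <;> rcases hsum' with hsum' | hsum'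
    · exact absurd (add_left_cancel (hsum.trans hsum'.symm)) hidx
    · rw [hsum, hsum']
      simp only [h01, h01.symm, true_and, false_and, or_false, false_or]
    · rw [hsum, hsum']
      simp only [h01, h01.symm, true_and, false_and, or_false, false_or]
    · exact absurd (add_left_cancel (hsum.trans hsum'.symm)) hidx

theorem finite_faces (h : K.IsTripartiteModel f) : K.faces.Finite := by
  refine (Set.finite_iUnion fun q : ZMod p × ZMod p × ZMod p =>
    (triangleOf f q.1 q.2.1 q.2.2).powerset.finite_toSet).subset fun s hs => ?_
  obtain ⟨-, x, y, z, -, hsub⟩ := h.mem_faces_iff_subset.1 hs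
  exact Set.mem_iUnion.2 ⟨(x, y, z), by simpa using hsub⟩

end IsTripartiteModel

/-! ### Compactness and connectedness of the realization -/

/-- The closed simplex spanned by the finite set `s`, in barycentric coordinates. -/
def closedSimplex (s : Finset V) : Set (V → ℝ) :=
  {t | (∀ v, 0 ≤ t v) ∧ (∀ v, v ∉ s → t v = 0) ∧ ∑ v ∈ s, t v = 1}

theorem convex_closedSimplex (s : Finset V) : Convex ℝ (closedSimplex s) := by
  rintro t ⟨h0, h1, h2⟩ u ⟨k0, k1, k2⟩ a b ha hb hab
  refine ⟨fun v => ?_, fun v hv => ?_, ?_⟩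
  · have := h0 v
    have := k0 v
    simp only [Pi.add_apply, Pi.smul_apply, smul_eq_mul]
    positivity
  · simp [h1 v hv, k1 v hv]
  · simp only [Pi.add_apply, Pi.smul_apply, smul_eq_mul]
    rw [Finset.sum_add_distrib, ← Finset.mul_sum, ← Finset.mul_sum, h2, k2, mul_one, mul_one, hab]

theorem isCompact_closedSimplex (s : Finset V) : IsCompact (closedSimplex s) := by
  refine (isCompact_univ_pi fun _ : V => isCompact_Icc (a := (0 : ℝ)) (b := 1)).of_isClosed_subset
    ?_ ?_
  · refine IsClosed.inter ?_ (IsClosed.inter ?_ ?_)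
    · change IsClosed {t : V → ℝ | ∀ v, 0 ≤ t v}
      rw [Set.ofPred_forall]
      exact isClosed_iInter fun v => isClosed_le continuous_const (continuous_apply v)
    · change IsClosed {t : V → ℝ | ∀ v, v ∉ s → t v = 0}
      simp only [Set.ofPred_forall]
      exact isClosed_iInter fun v => isClosed_iInter fun _ =>
        isClosed_eq (continuous_apply v) continuous_const
    · exact isClosed_eq (continuous_finsetSum _ fun v _ => continuous_apply v) continuous_const
  · rintro t ⟨h0, h1, h2⟩ v -
    refine ⟨h0 v, ?_⟩
    by_cases hv : v ∈ s
    · rw [← h2]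
      exact Finset.single_le_sum (fun u _ => h0 u) hv
    · rw [h1 v hv]
      exact zero_le_one

theorem closedSimplex_mono {s t : Finset V} (hst : s ⊆ t) : closedSimplex s ⊆ closedSimplex t := by
  rintro u ⟨h0, h1, h2⟩
  refine ⟨h0, fun v hv => h1 v fun hvs => hv (hst hvs), ?_⟩
  rw [← h2]
  exact (Finset.sum_subset hst fun v _ hv => h1 v hv).symm

open Classical in
theorem single_mem_closedSimplex {s : Finset V} {v : V} (hv : v ∈ s) :
    (Pi.single v 1 : V → ℝ) ∈ closedSimplex s := by
  refine ⟨fun u => ?_, fun u hu => ?_, ?_⟩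
  · by_cases h : u = v
    · subst h; simp
    · simp [h]
  · exact Pi.single_eq_of_ne (fun e => hu (by rwa [e])) _
  · simp [Finset.sum_pi_single', hv]

/-- A union of compact convex pieces: compactness follows from finiteness of the complex, and paths
can be assembled from segments. -/
theorem realization_eq (K : PreAbstractSimplicialComplex V) :
    {t : V → ℝ | (∀ v, 0 ≤ t v) ∧ ∃ s ∈ K.faces, (∀ v, v ∉ s → t v = 0) ∧ ∑ v ∈ s, t v = 1} =
      ⋃ s ∈ K.faces, closedSimplex s := by
  ext t
  simp only [Set.mem_ofPred_eq, Set.mem_iUnion, closedSimplex, exists_prop]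
  constructor
  · rintro ⟨h0, s, hs, h⟩
    exact ⟨s, hs, h0, h⟩
  · rintro ⟨s, hs, h0, h⟩
    exact ⟨h0, s, hs, h⟩

theorem compactSpace_realization {K : PreAbstractSimplicialComplex V} (hK : K.faces.Finite) :
    CompactSpace K.Realization := by
  refine isCompact_iff_compactSpace.1 (?_ : IsCompact {t : V → ℝ | (∀ v, 0 ≤ t v) ∧
    ∃ s ∈ K.faces, (∀ v, v ∉ s → t v = 0) ∧ ∑ v ∈ s, t v = 1})
  rw [realization_eq]
  exact hK.isCompact_biUnion fun s _ => isCompact_closedSimplex s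

namespace IsTripartiteModel

variable {K : PreAbstractSimplicialComplex V} {f : Fin 3 → ZMod p → V} [Fact p.Prime]

open Classical in
theorem connectedSpace_realization (h : K.IsTripartiteModel f) :
    ConnectedSpace K.Realization := by
  have hpc : IsPathConnected {t : V → ℝ | (∀ v, 0 ≤ t v) ∧
      ∃ s ∈ K.faces, (∀ v, v ∉ s → t v = 0) ∧ ∑ v ∈ s, t v = 1} := by
    rw [realization_eq]
    have hjoin : ∀ {x y z : ZMod p} {t u : V → ℝ}, x + y + z = 0 ∨ x + y + z = 1 →
        t ∈ closedSimplex (triangleOf f x y z) → u ∈ closedSimplex (triangleOf f x y z) →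
        JoinedIn (⋃ s ∈ K.faces, closedSimplex s) t u := fun hs ht hu =>
      JoinedIn.of_segment_subset (((convex_closedSimplex _).segment_subset ht hu).trans
        (Set.subset_biUnion_of_mem (u := fun s => closedSimplex s) (h.triangleOf_mem hs)))
    have h00 : (Pi.single (f 0 0) 1 : V → ℝ) ∈ closedSimplex (triangleOf f 0 0 0) :=
      single_mem_closedSimplex (by simp)
    refine ⟨Pi.single (f 0 0) 1, Set.mem_biUnion (h.triangleOf_mem (.inl (by simp))) h00,
      fun {t} ht => ?_⟩
    obtain ⟨s, hs, hts⟩ := Set.mem_iUnion₂.1 ht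
    obtain ⟨-, x, y, z, hsum, hsub⟩ := h.mem_faces_iff_subset.1 hs
    refine JoinedIn.symm ?_
    -- The path goes from the given point to `f 0 x`, then to `f 1 0`, then to `f 0 0`, each segment
    -- lying in one triangle; the second triangle has the indices `x, 0, -x`.
    refine (hjoin hsum (closedSimplex_mono hsub hts)
      (single_mem_closedSimplex (v := f 0 x) (by simp))).trans ?_
    refine (hjoin (x := x) (y := 0) (z := -x) (.inl (by simp))
      (single_mem_closedSimplex (by simp))
      (single_mem_closedSimplex (v := f 1 0) (by simp))).trans ?_
    exact hjoin (x := 0) (y := 0) (z := 0) (.inl (by simp))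
      (single_mem_closedSimplex (by simp)) h00
  have := isPathConnected_iff_pathConnectedSpace.1 hpc
  exact (inferInstance : ConnectedSpace {t : V → ℝ | (∀ v, 0 ≤ t v) ∧
      ∃ s ∈ K.faces, (∀ v, v ∉ s → t v = 0) ∧ ∑ v ∈ s, t v = 1})

/-! ### Simplex counts and the genus -/

theorem numSimplices_zero (h : K.IsTripartiteModel f) : K.numSimplices 0 = 3 * p := by
  have : {s | s ∈ K.faces ∧ s.card = 0 + 1} =
      Set.range fun q : Fin 3 × ZMod p => ({f q.1 q.2} : Finset V) := by
    ext s
    simp only [Set.mem_ofPred_eq, Set.mem_range, Prod.exists]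
    constructor
    · rintro ⟨hs, hc⟩
      obtain ⟨v, rfl⟩ := Finset.card_eq_one.1 hc
      obtain ⟨c, i, rfl⟩ := h.exists_of_mem hs (Finset.mem_singleton_self v)
      exact ⟨c, i, rfl⟩
    · rintro ⟨c, i, rfl⟩
      refine ⟨(h.mem_faces_rotate c _).2 ⟨by simp, i, 0, -i, by simp⟩, by simp⟩
  rw [numSimplices, this, ← Nat.card_coe_set_eq, Nat.card_range_of_injective]
  · simp
  · rintro ⟨c, i⟩ ⟨d, j⟩ e
    simpa [h.eq_iff] using e

open Classical in
-- Any two vertices of different colours span an edge, because the third index can be solved for.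
-- Each of the three pairs of colours has the form `c, c + 1` for exactly one `c`.
theorem numSimplices_one (h : K.IsTripartiteModel f) : K.numSimplices 1 = 3 * p ^ 2 := by
  have hc1 : ∀ c : Fin 3, c ≠ c + 1 := by decide
  have : {s | s ∈ K.faces ∧ s.card = 1 + 1} =
      Set.range fun q : Fin 3 × ZMod p × ZMod p =>
        ({f q.1 q.2.1, f (q.1 + 1) q.2.2} : Finset V) := by
    ext s
    simp only [Set.mem_ofPred_eq, Set.mem_range, Prod.exists]
    constructor
    · rintro ⟨hs, hc⟩
      obtain ⟨u, v, huv, rfl⟩ := Finset.card_eq_two.1 hc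
      obtain ⟨-, x, y, z, hsum, hsub⟩ := (h.mem_faces _).1 hs
      rcases hsub u (by simp) with rfl | rfl | rfl <;> rcases hsub v (by simp) with rfl | rfl | rfl
      · exact absurd rfl huv
      · exact ⟨0, x, y, rfl⟩
      · exact ⟨2, z, x, Finset.pair_comm _ _⟩
      · exact ⟨0, x, y, Finset.pair_comm _ _⟩
      · exact absurd rfl huv
      · exact ⟨1, y, z, rfl⟩
      · exact ⟨2, z, x, rfl⟩
      · exact ⟨1, y, z, Finset.pair_comm _ _⟩
      · exact absurd rfl huv
    · rintro ⟨c, i, j, rfl⟩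
      refine ⟨(h.mem_faces_rotate c _).2 ⟨by simp, i, j, -i-j, .inl (by ring), ?_⟩,
        Finset.card_pair (h.ne_of_color_ne (hc1 c) _ _)⟩
      intro v hv
      simp only [Finset.mem_insert, Finset.mem_singleton] at hv
      tauto
  rw [numSimplices, this, ← Nat.card_coe_set_eq, Nat.card_range_of_injective]
  · simp [sq]
  · rintro ⟨c, i, j⟩ ⟨d, i', j'⟩ e
    dsimp only at e
    have e1 : f c i ∈ ({f d i', f (d + 1) j'} : Finset V) := by rw [← e]; simp
    have e2 : f (c + 1) j ∈ ({f d i', f (d + 1) j'} : Finset V) := by rw [← e]; simp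
    simp only [Finset.mem_insert, Finset.mem_singleton, h.eq_iff] at e1 e2
    have hcd : c = d := by
      have k1 : c = d ∨ c = d + 1 := e1.imp And.left And.left
      have k2 : c + 1 = d ∨ c + 1 = d + 1 := e2.imp And.left And.left
      clear e e1 e2
      revert c d
      decide
    subst hcd
    simp only [hc1 c, (hc1 c).symm, false_and, or_false, false_or, true_and] at e1 e2
    rw [e1, e2]

/-- A triangle is determined by its sum and its first two indices. -/
theorem numSimplices_two (h : K.IsTripartiteModel f) : K.numSimplices 2 = 2 * p ^ 2 := by
  have : {s | s ∈ K.faces ∧ s.card = 2 + 1} =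
      Set.range fun q : Fin 2 × ZMod p × ZMod p =>
        triangleOf f q.2.1 q.2.2 ((q.1.val : ZMod p) - q.2.1 - q.2.2) := by
    ext s
    simp only [Set.mem_ofPred_eq, Set.mem_range, Prod.exists]
    constructor
    · rintro ⟨hs, hc⟩
      obtain ⟨-, x, y, z, hsum, hsub⟩ := h.mem_faces_iff_subset.1 hs
      have e := Finset.eq_of_subset_of_card_le hsub (by rw [hc, h.card_triangleOf])
      rcases hsum with hsum | hsum
      · refine ⟨0, x, y, ?_⟩
        rw [e]
        congr 1
        simp only [Fin.val_zero, Nat.cast_zero]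
        linear_combination -hsum
      · refine ⟨1, x, y, ?_⟩
        rw [e]
        congr 1
        simp only [Fin.val_one, Nat.cast_one]
        linear_combination -hsum
    · rintro ⟨c, i, j, rfl⟩
      refine ⟨h.triangleOf_mem ?_, h.card_triangleOf _ _ _⟩
      fin_cases c
      · left; simp
      · right; simp
  rw [numSimplices, this, ← Nat.card_coe_set_eq, Nat.card_range_of_injective]
  · simp [sq]
  · rintro ⟨c, i, j⟩ ⟨d, i', j'⟩ e
    dsimp only at e
    have e1 : f 0 i ∈ triangleOf f i' j' (d.val - i' - j') := by rw [← e]; simp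
    have e2 : f 1 j ∈ triangleOf f i' j' (d.val - i' - j') := by rw [← e]; simp
    have e3 : f 2 (c.val - i - j) ∈ triangleOf f i' j' (d.val - i' - j') := by rw [← e]; simp
    simp [h.eq_iff] at e1 e2 e3
    subst e1 e2
    have h01 : (0 : ZMod p) ≠ 1 := zero_ne_one
    have hcd : c = d := by
      have e4 : ((c.val : ℕ) : ZMod p) = d.val := by linear_combination e3
      clear e e3
      fin_cases c <;> fin_cases d <;> simp_all
    rw [hcd]

theorem isSurfaceOfGenus (h : K.IsTripartiteModel f) (hp : Odd p) :
    K.IsSurfaceOfGenus (p * (p - 3) / 2 + 1) where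
  finite := h.finite_faces
  pure s hs := by
    obtain ⟨-, x, y, z, hsum, hsub⟩ := h.mem_faces_iff_subset.1 hs
    exact ⟨_, h.triangleOf_mem hsum, hsub, h.card_triangleOf _ _ _⟩
  dim_le s hs := by
    obtain ⟨-, x, y, z, hsum, hsub⟩ := h.mem_faces_iff_subset.1 hs
    exact (Finset.card_le_card hsub).trans (h.card_triangleOf _ _ _).le
  compact := compactSpace_realization h.finite_faces
  connected := h.connectedSpace_realization
  manifold := h.nonempty_chartedSpace hp
  orientable := h.orientable
  euler := by
    rw [h.numSimplices_zero, h.numSimplices_one, h.numSimplices_two]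
    have h3 : 3 ≤ p := by
      have := (Fact.out : p.Prime).two_le
      obtain ⟨k, rfl⟩ := hp
      omega
    obtain ⟨k, rfl⟩ := hp
    -- With `p = 2m + 3`, the truncated subtraction and the division by `2` in the genus are exact.
    obtain ⟨m, rfl⟩ : ∃ m, k = m + 1 := ⟨k - 1, by omega⟩
    rw [show (2 * (m + 1) + 1) * (2 * (m + 1) + 1 - 3) / 2 = (2 * m + 3) * m by
      rw [show 2 * (m + 1) + 1 - 3 = 2 * m by omega]
      rw [show (2 * (m + 1) + 1) * (2 * m) = 2 * ((2 * m + 3) * m) by ring]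
      exact Nat.mul_div_cancel_left _ two_pos]
    push_cast
    ring

end IsTripartiteModel

end Tripartite

end PreAbstractSimplicialComplex

/-! ### The poset of the map of `K_{p,p}` with `p` faces -/

/-- The cells of the map on a surface with the vertices `vert e i`, the edges `edge x y` joining
`vert false x` to `vert true y`, and the faces `face k`, where `face k` contains `edge x y` if
`x + y + k` is `0` or `1`; there are also a least cell and a greatest cell. -/
inductive BipartiteCell (p : ℕ)
  | bot
  | vert (e : Bool) (i : ZMod p)
  | edge (x y : ZMod p)
  | face (k : ZMod p)
  | top

namespace BipartiteCell

variable {p : ℕ}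

/-- The incidence relation. -/
def Incident : BipartiteCell p → BipartiteCell p → Prop
  | bot, _ => True
  | vert _ _, bot => False
  | vert e i, vert e' i' => e = e' ∧ i = i'
  | vert e i, edge x y => i = cond e y x
  | vert _ _, face _ => True
  | vert _ _, top => True
  | edge _ _, bot => False
  | edge _ _, vert _ _ => False
  | edge x y, edge x' y' => x = x' ∧ y = y'
  | edge x y, face k => x + y + k = 0 ∨ x + y + k = 1
  | edge _ _, top => True
  | face _, bot => False
  | face _, vert _ _ => False
  | face _, edge _ _ => False
  | face k, face k' => k = k'
  | face _, top => True
  | top, bot => False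
  | top, vert _ _ => False
  | top, edge _ _ => False
  | top, face _ => False
  | top, top => True

/-- The rank of a cell, counted from `0` for the least cell. -/
def rank : BipartiteCell p → ℕ
  | bot => 0
  | vert _ _ => 1
  | edge _ _ => 2
  | face _ => 3
  | top => 4

theorem Incident.rank_le {a b : BipartiteCell p} (h : Incident a b) : rank a ≤ rank b := by
  cases a <;> cases b <;> simp_all [Incident, rank]

theorem Incident.eq_of_rank_eq {a b : BipartiteCell p} (h : Incident a b)
    (hr : rank a = rank b) : a = b := by
  cases a <;> cases b <;> simp_all [Incident, rank]

theorem Incident.trans {a b c : BipartiteCell p} (h : Incident a b) (h' : Incident b c) :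
    Incident a c := by
  cases a <;> cases b <;> cases c <;> simp_all [Incident]

instance : PartialOrder (BipartiteCell p) where
  le := Incident
  le_refl a := by cases a <;> simp [Incident]
  le_trans _ _ _ := Incident.trans
  le_antisymm _ _ h h' := h.eq_of_rank_eq (h.rank_le.antisymm h'.rank_le)

theorem le_iff {a b : BipartiteCell p} : a ≤ b ↔ Incident a b := Iff.rfl

theorem rank_strictMono : StrictMono (rank : BipartiteCell p → ℕ) := fun _ _ h =>
  (Incident.rank_le h.le).lt_of_ne fun e => h.ne (Incident.eq_of_rank_eq h.le e)

theorem lt_iff {a b : BipartiteCell p} : a < b ↔ Incident a b ∧ rank a < rank b :=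
  ⟨fun h => ⟨h.le, rank_strictMono h⟩, fun h => lt_of_le_of_ne h.1 fun e => by simp [e] at h⟩

/-- No rank is skipped going down; this is the lower bound for the height in `height_eq`. -/
theorem exists_lt_rank (a : BipartiteCell p) (n : ℕ) (h : rank a = n + 1) :
    ∃ b < a, rank b = n := by
  cases a with
  | bot => simp [rank] at h
  | vert e i => exact ⟨bot, lt_iff.2 ⟨trivial, by simp [rank]⟩, by simp_all [rank]⟩
  | edge x y => exact ⟨vert false x, lt_iff.2 ⟨by simp [Incident], by simp [rank]⟩,
      by simp_all [rank]⟩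
  | face k => exact ⟨edge (-k) 0, lt_iff.2 ⟨by simp [Incident], by simp [rank]⟩,
      by simp_all [rank]⟩
  | top => exact ⟨face 0, lt_iff.2 ⟨trivial, by simp [rank]⟩, by simp_all [rank]⟩

theorem height_eq (a : BipartiteCell p) : Order.height a = rank a := by
  apply le_antisymm
  · have := Order.height_le_height_apply_of_strictMono rank rank_strictMono a
    rwa [Order.height_nat] at this
  · generalize h : rank a = n
    induction n generalizing a with
    | zero => simp
    | succ n ih =>
      obtain ⟨b, hb, hr⟩ := exists_lt_rank a n h
      have := Order.height_add_one_le hb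
      push_cast
      exact (add_le_add_left (ih b hr) 1).trans this

theorem isLeast_bot : IsLeast Set.univ (bot : BipartiteCell p) := ⟨trivial, fun _ _ => trivial⟩

theorem isGreatest_top : IsGreatest Set.univ (top : BipartiteCell p) :=
  ⟨trivial, fun a _ => by cases a <;> trivial⟩

/-- A flag contains every cell comparable with all of its members. A missing rank can always be
filled compatibly with what is present: first a face, then an edge, then a vertex. -/
theorem flag_eq (Φ : Flag (BipartiteCell p)) : ∃ (e : Bool) (x y k : ZMod p),
    (x + y + k = 0 ∨ x + y + k = 1) ∧
    (Φ : Set (BipartiteCell p)) = {bot, vert e (cond e y x), edge x y, face k, top} := by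
  have hcomp : ∀ {a b}, a ∈ Φ → b ∈ Φ → Incident a b ∨ Incident b a := fun ha hb =>
    Φ.le_or_le ha hb
  have hmem : ∀ {a}, (∀ b ∈ Φ, Incident a b ∨ Incident b a) → a ∈ Φ := fun h =>
    Flag.mem_iff_forall_le_or_ge.2 fun b hb => h b hb
  have hbot : bot ∈ Φ := hmem fun b _ => .inl trivial
  have htop : top ∈ Φ := hmem fun b _ => .inr (by cases b <;> trivial)
  obtain ⟨k, hk⟩ : ∃ k, face k ∈ Φ := by
    by_contra! hno
    by_cases he : ∃ x y, edge x y ∈ Φ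
    · obtain ⟨x, y, he⟩ := he
      refine hno (-x - y) (hmem fun b hb => ?_)
      cases b with
      | bot => exact .inr trivial
      | vert e i => exact .inr trivial
      | edge x' y' =>
        right
        have := hcomp he hb
        simp only [Incident] at this
        left
        rcases this with ⟨rfl, rfl⟩ | ⟨rfl, rfl⟩ <;> ring
      | face k => exact absurd hb (hno k)
      | top => exact .inl trivial
    · push Not at he
      refine hno 0 (hmem fun b hb => ?_)
      cases b with
      | bot => exact .inr trivial
      | vert e i => exact .inr trivial
      | edge x' y' => exact absurd hb (he _ _)
      | face k => exact absurd hb (hno k)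
      | top => exact .inl trivial
  obtain ⟨x, y, hxy⟩ : ∃ x y, edge x y ∈ Φ := by
    by_contra! hno
    -- It suffices to find an edge of sum `0` at the face `k` whose ends agree with any vertex
    -- already in the flag.
    have key : ∀ x y, x + y + k = 0 → (∀ e i, vert e i ∈ Φ → i = cond e y x) → False := by
      intro x y hs hv
      refine hno x y (hmem fun b hb => ?_)
      cases b with
      | bot => exact .inr trivial
      | vert e i => exact .inr (hv e i hb)
      | edge x' y' => exact absurd hb (hno _ _)
      | face k' =>
        have := hcomp hk hb
        simp only [Incident] at this
        left
        left
        rcases this with rfl | rfl <;> exact hs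
      | top => exact .inl trivial
    by_cases hv : ∃ e i, vert e i ∈ Φ
    · obtain ⟨e, i, hi⟩ := hv
      have huniq : ∀ e' i', vert e' i' ∈ Φ → e' = e ∧ i' = i := by
        intro e' i' h'
        have := hcomp hi h'
        simp only [Incident] at this
        rcases this with ⟨rfl, rfl⟩ | ⟨rfl, rfl⟩ <;> exact ⟨rfl, rfl⟩
      refine key (cond e (-i - k) i) (cond e i (-i - k)) (by cases e <;> simp only [cond] <;> ring)
        ?_
      intro e' i' h'
      obtain ⟨rfl, rfl⟩ := huniq _ _ h'
      cases e' <;> rfl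
    · push Not at hv
      exact key (-k) 0 (by simp) fun e i h => absurd h (hv e i)
  obtain ⟨e, i, hi⟩ : ∃ e i, vert e i ∈ Φ := by
    by_contra! hno
    refine hno false x (hmem fun b hb => ?_)
    cases b with
    | bot => exact .inr trivial
    | vert e i => exact absurd hb (hno _ _)
    | edge x' y' =>
      have := hcomp hxy hb
      simp only [Incident] at this
      left
      rcases this with ⟨rfl, rfl⟩ | ⟨rfl, rfl⟩ <;> rfl
    | face k' => exact .inl trivial
    | top => exact .inl trivial
  have hie : i = cond e y x := (hcomp hi hxy).resolve_right id
  subst hie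
  refine ⟨e, x, y, k, (hcomp hxy hk).resolve_right id, Set.Subset.antisymm ?_ ?_⟩
  · intro b hb
    simp only [Set.mem_insert_iff, Set.mem_singleton_iff]
    cases b with
    | bot => simp
    | vert e' i' =>
      have := hcomp hi hb
      simp only [Incident] at this
      rcases this with ⟨rfl, rfl⟩ | ⟨rfl, rfl⟩ <;> simp
    | edge x' y' =>
      have := hcomp hxy hb
      simp only [Incident] at this
      rcases this with ⟨rfl, rfl⟩ | ⟨rfl, rfl⟩ <;> simp
    | face k' =>
      have := hcomp hk hb
      simp only [Incident] at this
      rcases this with rfl | rfl <;> simp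
    | top => simp
  · rintro b (rfl | rfl | rfl | rfl | rfl)
    exacts [hbot, hi, hxy, hk, htop]

theorem ncard_flag (Φ : Flag (BipartiteCell p)) : (Φ : Set (BipartiteCell p)).ncard = 3 + 2 := by
  obtain ⟨e, x, y, k, -, h⟩ := flag_eq Φ
  rw [h, Set.ncard_insert_of_notMem (by simp), Set.ncard_insert_of_notMem (by simp),
    Set.ncard_insert_of_notMem (by simp), Set.ncard_pair (by simp)]

/-- The automorphism adding constants to the indices. -/
def shift (a b : ZMod p) : BipartiteCell p ≃o BipartiteCell p where
  toFun
    | bot => bot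
    | vert e i => vert e (i + cond e b a)
    | edge x y => edge (x + a) (y + b)
    | face k => face (k - a - b)
    | top => top
  invFun
    | bot => bot
    | vert e i => vert e (i - cond e b a)
    | edge x y => edge (x - a) (y - b)
    | face k => face (k + a + b)
    | top => top
  left_inv c := by cases c <;> simp; ring
  right_inv c := by cases c <;> simp; ring
  map_rel_iff' := by
    intro c d
    simp only [le_iff]
    rcases c with _ | ⟨e, i⟩ | ⟨x, y⟩ | k | _ <;> rcases d with _ | ⟨e', i'⟩ | ⟨x', y'⟩ | k' | _ <;>
      simp only [Equiv.coe_fn_mk, Incident]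
    · exact and_congr_right fun h => by simp [h]
    · cases e <;> simp
    · simp
    · ring_nf
    · simp

/-- The automorphism exchanging the two classes of vertices. -/
def swap : BipartiteCell p ≃o BipartiteCell p where
  toFun
    | bot => bot
    | vert e i => vert (!e) i
    | edge x y => edge y x
    | face k => face k
    | top => top
  invFun
    | bot => bot
    | vert e i => vert (!e) i
    | edge x y => edge y x
    | face k => face k
    | top => top
  left_inv c := by cases c <;> simp
  right_inv c := by cases c <;> simp
  map_rel_iff' := by
    intro c d
    simp only [le_iff]
    rcases c with _ | ⟨e, i⟩ | ⟨x, y⟩ | k | _ <;> rcases d with _ | ⟨e', i'⟩ | ⟨x', y'⟩ | k' | _ <;>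
      simp only [Equiv.coe_fn_mk, Incident]
    · simp
    · cases e <;> simp
    · exact and_comm
    · rw [add_comm y x]

/-- The automorphism changing the signs of the indices of the vertices. -/
def reflect : BipartiteCell p ≃o BipartiteCell p where
  toFun
    | bot => bot
    | vert e i => vert e (-i)
    | edge x y => edge (-x) (-y)
    | face k => face (1 - k)
    | top => top
  invFun
    | bot => bot
    | vert e i => vert e (-i)
    | edge x y => edge (-x) (-y)
    | face k => face (1 - k)
    | top => top
  left_inv c := by cases c <;> simp
  right_inv c := by cases c <;> simp
  map_rel_iff' := by
    intro c d
    simp only [le_iff]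
    rcases c with _ | ⟨e, i⟩ | ⟨x, y⟩ | k | _ <;> rcases d with _ | ⟨e', i'⟩ | ⟨x', y'⟩ | k' | _ <;>
      simp only [Equiv.coe_fn_mk, Incident]
    · simp
    · cases e <;> simp
    · simp
    -- The sign change sends the sum `s` to `1 - s`, so the two kinds of incidence are exchanged.
    · constructor
      · rintro (h | h)
        · right; linear_combination -h
        · left; linear_combination -h
      · rintro (h | h)
        · right; linear_combination -h
        · left; linear_combination -h
    · simp

/-- A shift moves the edge to `edge 0 0`; the face then has index `0` or `1`, and `reflect` corrects
the second case while fixing that edge. If the vertex is of the wrong class, `swap` exchanges the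
two ends. -/
theorem exists_smul_flag (Φ : Flag (BipartiteCell p)) : ∃ g : BipartiteCell p ≃o BipartiteCell p,
    ((g • Φ : Flag (BipartiteCell p)) : Set (BipartiteCell p)) =
      {bot, vert false 0, edge 0 0, face 0, top} := by
  obtain ⟨e, x, y, k, hs, h⟩ := flag_eq Φ
  have himg : ∀ (g : BipartiteCell p ≃o BipartiteCell p) (Ψ : Flag (BipartiteCell p)) (a b c d f),
      (Ψ : Set (BipartiteCell p)) = {a, b, c, d, f} →
      ((g • Ψ : Flag (BipartiteCell p)) : Set (BipartiteCell p)) = {g a, g b, g c, g d, g f} := by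
    intro g Ψ a b c d f h
    rw [Flag.coe_smul, h, ← Set.image_smul]
    simp only [Set.image_insert_eq, Set.image_singleton, RelIso.smul_def]
  have h1 : ((shift (-x) (-y) • Φ : Flag (BipartiteCell p)) : Set (BipartiteCell p)) =
      {bot, vert e 0, edge 0 0, face (x + y + k), top} := by
    rw [himg _ _ _ _ _ _ _ h,
      show shift (-x) (-y) (vert e (cond e y x)) = vert e 0 by cases e <;> simp [shift],
      show shift (-x) (-y) (edge x y) = edge 0 0 by simp [shift],
      show shift (-x) (-y) (face k) = face (x + y + k) from congrArg face (by ring)]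
    rfl
  obtain ⟨g, hg⟩ : ∃ g : BipartiteCell p ≃o BipartiteCell p,
      ((g • Φ : Flag (BipartiteCell p)) : Set (BipartiteCell p)) =
      {bot, vert e 0, edge 0 0, face 0, top} := by
    rcases hs with hs | hs
    · exact ⟨_, by rw [h1, hs]⟩
    · refine ⟨reflect * shift (-x) (-y), ?_⟩
      rw [mul_smul, himg _ _ _ _ _ _ _ h1, hs]
      simp [reflect]
  cases e with
  | false => exact ⟨g, hg⟩
  | true => exact ⟨swap * g, by rw [mul_smul, himg _ _ _ _ _ _ _ hg]; rfl⟩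

theorem isPretransitive_flag :
    MulAction.IsPretransitive (BipartiteCell p ≃o BipartiteCell p) (Flag (BipartiteCell p)) where
  exists_smul_eq Φ Ψ := by
    obtain ⟨g, hg⟩ := exists_smul_flag Φ
    obtain ⟨g', hg'⟩ := exists_smul_flag Ψ
    exact ⟨g'⁻¹ * g, by
      rw [mul_smul, inv_smul_eq_iff]
      exact SetLike.coe_injective (hg.trans hg'.symm)⟩

theorem mem_Ioo_iff {F G H : BipartiteCell p} : H ∈ Set.Ioo F G ↔
    (Incident F H ∧ rank F < rank H) ∧ Incident H G ∧ rank H < rank G := by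
  rw [Set.mem_Ioo, lt_iff, lt_iff]

/-- The three cases are the two ends of an edge, the two edges of a face at one of its vertices, and
the two faces at an edge; in the last two, the alternatives are the sums `0` and `1`. -/
theorem diamond [Fact p.Prime] (F G : BipartiteCell p) (hlt : F < G)
    (hr : Order.height F + 2 = Order.height G) : (Set.Ioo F G).ncard = 2 := by
  have h01 : (0 : ZMod p) ≠ 1 := zero_ne_one
  rw [height_eq, height_eq] at hr
  replace hr : rank F + 2 = rank G := by exact_mod_cast hr
  have hinc := hlt.le
  rw [Set.ncard_eq_two]
  rcases F with _ | ⟨e, i⟩ | ⟨x, y⟩ | k | _ <;> rcases G with _ | ⟨e', i'⟩ | ⟨x', y'⟩ | k' | _ <;>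
    simp only [rank] at hr <;> try omega
  · refine ⟨vert false x', vert true y', by simp, ?_⟩
    ext H
    rw [mem_Ioo_iff]
    rcases H with _ | ⟨e, i⟩ | ⟨x, y⟩ | k | _ <;> simp [Incident, rank]
    cases e <;> simp
  · cases e
    · refine ⟨edge i (-(i + k')), edge i (1 - (i + k')), by simp [sub_eq_add_neg], ?_⟩
      ext H
      rw [mem_Ioo_iff]
      rcases H with _ | ⟨e, i'⟩ | ⟨x, y⟩ | k | _ <;> simp [Incident, rank]
      constructor
      · rintro ⟨rfl, h | h⟩
        · exact .inl ⟨rfl, by linear_combination h⟩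
        · exact .inr ⟨rfl, by linear_combination h⟩
      · rintro (⟨rfl, rfl⟩ | ⟨rfl, rfl⟩)
        · exact ⟨rfl, .inl (by ring)⟩
        · exact ⟨rfl, .inr (by ring)⟩
    · refine ⟨edge (-(i + k')) i, edge (1 - (i + k')) i, by simp [sub_eq_add_neg], ?_⟩
      ext H
      rw [mem_Ioo_iff]
      rcases H with _ | ⟨e, i'⟩ | ⟨x, y⟩ | k | _ <;> simp [Incident, rank]
      constructor
      · rintro ⟨rfl, h | h⟩
        · exact .inl ⟨by linear_combination h, rfl⟩
        · exact .inr ⟨by linear_combination h, rfl⟩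
      · rintro (⟨rfl, rfl⟩ | ⟨rfl, rfl⟩)
        · exact ⟨rfl, .inl (by ring)⟩
        · exact ⟨rfl, .inr (by ring)⟩
  · refine ⟨face (-(x + y)), face (1 - (x + y)), by simp [sub_eq_add_neg], ?_⟩
    ext H
    rw [mem_Ioo_iff]
    rcases H with _ | ⟨e, i⟩ | ⟨x', y'⟩ | k | _ <;> simp [Incident, rank]
    constructor
    · rintro (h | h)
      · left; linear_combination h
      · right; linear_combination h
    · rintro (rfl | rfl)
      · left; ring
      · right; ring

end BipartiteCell

/-! ### Connectedness of sections and the Schläfli symbol -/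

/-- Consecutive proper faces of the section between `F` and `G`. -/
abbrev SectionStep {P : Type*} [PartialOrder P] (F G A B : P) : Prop :=
  B ∈ Set.Ioo F G ∧ (A ≤ B ∨ B ≤ A)

/-- A step records membership in the section only for its target, so reversing a path needs the
hypothesis on its source. -/
theorem SectionStep.reflTransGen_symm {P : Type*} [PartialOrder P] {F G A B : P}
    (hA : A ∈ Set.Ioo F G) (h : Relation.ReflTransGen (SectionStep F G) A B) :
    B ∈ Set.Ioo F G ∧ Relation.ReflTransGen (SectionStep F G) B A := by
  induction h with
  | refl => exact ⟨hA, .refl⟩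
  | tail _ hs ih => exact ⟨hs.1, .head ⟨ih.1, hs.2.symm⟩ ih.2⟩

theorem SectionStep.connected_of_base {P : Type*} [PartialOrder P] {F G A : P}
    (hA : A ∈ Set.Ioo F G)
    (h : ∀ H ∈ Set.Ioo F G, Relation.ReflTransGen (SectionStep F G) A H) :
    ∀ H ∈ Set.Ioo F G, ∀ K ∈ Set.Ioo F G, Relation.ReflTransGen (SectionStep F G) H K :=
  fun H hH K hK => (SectionStep.reflTransGen_symm hA (h H hH)).2.trans (h K hK)

theorem ZMod.induction_add_one {p : ℕ} [NeZero p] {Q : ZMod p → Prop} (h0 : Q 0)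
    (h1 : ∀ i, Q i → Q (i + 1)) (i : ZMod p) : Q i := by
  have : ∀ n : ℕ, Q n := fun n => by
    induction n with
    | zero => simpa using h0
    | succ n ih => simpa using h1 _ ih
  simpa using this i.val

namespace BipartiteCell

variable {p : ℕ}

theorem connected_face [NeZero p] (k : ZMod p) : ∀ H ∈ Set.Ioo bot (face k),
    ∀ K ∈ Set.Ioo bot (face k), Relation.ReflTransGen (SectionStep bot (face k)) H K := by
  have hv : ∀ e i, vert e i ∈ Set.Ioo bot (face k) := fun e i =>
    mem_Ioo_iff.2 ⟨⟨trivial, by simp [rank]⟩, trivial, by simp [rank]⟩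
  have he : ∀ x y, (x + y + k = 0 ∨ x + y + k = 1) → edge x y ∈ Set.Ioo bot (face k) :=
    fun x y h => mem_Ioo_iff.2 ⟨⟨trivial, by simp [rank]⟩, h, by simp [rank]⟩
  have s1 : ∀ x y, (x + y + k = 0 ∨ x + y + k = 1) →
      SectionStep bot (face k) (vert false x) (edge x y) := fun x y h => ⟨he x y h, .inl rfl⟩
  have s2 : ∀ x y, SectionStep bot (face k) (edge x y) (vert true y) :=
    fun x y => ⟨hv _ _, .inr rfl⟩
  have s3 : ∀ x y, (x + y + k = 0 ∨ x + y + k = 1) →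
      SectionStep bot (face k) (vert true y) (edge x y) := fun x y h => ⟨he x y h, .inl rfl⟩
  have s4 : ∀ x y, SectionStep bot (face k) (edge x y) (vert false x) :=
    fun x y => ⟨hv _ _, .inr rfl⟩
  have hfalse : ∀ i, Relation.ReflTransGen (SectionStep bot (face k)) (vert false 0)
      (vert false i) := by
    apply ZMod.induction_add_one
    · exact .refl
    · intro i hi
      -- Two edges of the polygon: sum `0` leads from `x = i` to `y = -i - k`, and sum `1` leads
      -- back to `x = i + 1`.
      exact (((hi.tail (s1 i (-i - k) (.inl (by ring)))).tail (s2 _ _)).tail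
        (s3 (i + 1) (-i - k) (.inr (by ring)))).tail (s4 _ _)
  refine SectionStep.connected_of_base (hv false 0) fun H hH => ?_
  rw [mem_Ioo_iff] at hH
  rcases H with _ | ⟨_ | _, i⟩ | ⟨x, y⟩ | k | _ <;> simp only [Incident, rank] at hH
  · omega
  · exact hfalse i
  · exact ((hfalse (-i - k)).tail (s1 (-i - k) i (.inl (by ring)))).tail (s2 _ _)
  · exact (hfalse x).tail (s1 x y hH.2.1)
  · omega
  · omega

theorem connected_bot_top : ∀ H ∈ Set.Ioo (bot : BipartiteCell p) top,
    ∀ K ∈ Set.Ioo (bot : BipartiteCell p) top,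
      Relation.ReflTransGen (SectionStep (bot : BipartiteCell p) top) H K := by
  have hv : ∀ e i, vert e i ∈ Set.Ioo (bot : BipartiteCell p) top := fun e i =>
    mem_Ioo_iff.2 ⟨⟨trivial, by simp [rank]⟩, trivial, by simp [rank]⟩
  have he : ∀ x y, edge x y ∈ Set.Ioo (bot : BipartiteCell p) top := fun x y =>
    mem_Ioo_iff.2 ⟨⟨trivial, by simp [rank]⟩, trivial, by simp [rank]⟩
  have s1 : ∀ x y : ZMod p, SectionStep bot top (vert false x) (edge x y) :=
    fun x y => ⟨he x y, .inl rfl⟩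
  have s2 : ∀ x y : ZMod p, SectionStep bot top (edge x y) (vert true y) :=
    fun x y => ⟨hv _ _, .inr rfl⟩
  have s3 : ∀ x y : ZMod p, SectionStep bot top (vert true y) (edge x y) :=
    fun x y => ⟨he x y, .inl rfl⟩
  have s4 : ∀ x y : ZMod p, SectionStep bot top (edge x y) (vert false x) :=
    fun x y => ⟨hv _ _, .inr rfl⟩
  have htrue : ∀ i : ZMod p, Relation.ReflTransGen (SectionStep bot top) (vert false (0 : ZMod p))
      (vert true i) := fun i => (Relation.ReflTransGen.single (s1 0 i)).tail (s2 _ _)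
  have hfalse : ∀ i : ZMod p, Relation.ReflTransGen (SectionStep bot top) (vert false (0 : ZMod p))
      (vert false i) := fun i => ((htrue 0).tail (s3 i 0)).tail (s4 _ _)
  refine SectionStep.connected_of_base (hv false 0) fun H hH => ?_
  have hH' := hH
  rw [mem_Ioo_iff] at hH
  rcases H with _ | ⟨_ | _, i⟩ | ⟨x, y⟩ | k | _ <;> simp only [Incident, rank] at hH
  · omega
  · exact hfalse i
  · exact htrue i
  · exact (hfalse x).tail (s1 x y)
  · exact .single ⟨hH', .inl trivial⟩
  · omega

theorem connected_vert_top [NeZero p] (e : Bool) (i : ZMod p) : ∀ H ∈ Set.Ioo (vert e i) top,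
    ∀ K ∈ Set.Ioo (vert e i) top,
      Relation.ReflTransGen (SectionStep (vert e i) top) H K := by
  have hf : ∀ k, face k ∈ Set.Ioo (vert e i) top := fun k =>
    mem_Ioo_iff.2 ⟨⟨trivial, by simp [rank]⟩, trivial, by simp [rank]⟩
  have he : ∀ x y, i = cond e y x → edge x y ∈ Set.Ioo (vert e i) top := fun x y h =>
    mem_Ioo_iff.2 ⟨⟨h, by simp [rank]⟩, trivial, by simp [rank]⟩
  have s1 : ∀ x y k, i = cond e y x → (x + y + k = 0 ∨ x + y + k = 1) →
      SectionStep (vert e i) top (face k) (edge x y) := fun x y k h h' => ⟨he x y h, .inr h'⟩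
  have s2 : ∀ x y k, (x + y + k = 0 ∨ x + y + k = 1) →
      SectionStep (vert e i) top (edge x y) (face k) := fun x y k h => ⟨hf k, .inl h⟩
  have hface : ∀ k, Relation.ReflTransGen (SectionStep (vert e i) top) (face 0) (face k) := by
    apply ZMod.induction_add_one
    · exact .refl
    · intro k hk
      cases e
      -- The edge of sum `0` with face `k` has sum `1` with face `k + 1`, so it separates these two
      -- faces.
      · exact (hk.tail (s1 i (-i - k) k rfl (.inl (by ring)))).tail
          (s2 _ _ _ (.inr (by ring)))
      · exact (hk.tail (s1 (-i - k) i k rfl (.inl (by ring)))).tail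
          (s2 _ _ _ (.inr (by ring)))
  refine SectionStep.connected_of_base (hf 0) fun H hH => ?_
  rw [mem_Ioo_iff] at hH
  rcases H with _ | ⟨e', i'⟩ | ⟨x, y⟩ | k | _ <;> simp only [Incident, rank] at hH
  · omega
  · omega
  · exact (hface (-x - y)).tail (s1 x y _ hH.1.1 (.inl (by ring)))
  · exact hface k
  · omega

theorem connected [NeZero p] (F G : BipartiteCell p)
    (hr : Order.height F + 3 ≤ Order.height G) : ∀ H ∈ Set.Ioo F G, ∀ K ∈ Set.Ioo F G,
      Relation.ReflTransGen (SectionStep F G) H K := by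
  rw [height_eq, height_eq] at hr
  replace hr : rank F + 3 ≤ rank G := by exact_mod_cast hr
  rcases F with _ | ⟨e, i⟩ | ⟨x, y⟩ | k | _ <;> rcases G with _ | ⟨e', i'⟩ | ⟨x', y'⟩ | k' | _ <;>
    simp only [rank] at hr <;> try omega
  · exact connected_face k'
  · exact connected_bot_top
  · exact connected_vert_top e i

variable (p) in
theorem isRegularPolytope [Fact p.Prime] : IsRegularPolytope (BipartiteCell p) 3 :=
  ⟨{ exists_bot := ⟨_, isLeast_bot⟩
     exists_top := ⟨_, isGreatest_top⟩
     ncard_flag := ncard_flag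
     connected := fun F G _ hr => connected F G hr
     diamond := diamond }, isPretransitive_flag⟩

/-- The first index and the sum determine the second index. The count serves both the Schläfli
symbol and the number of edges of a 2-cell. -/
theorem ncard_edges_face [Fact p.Prime] (k : ZMod p) :
    {q : ZMod p × ZMod p | q.1 + q.2 + k = 0 ∨ q.1 + q.2 + k = 1}.ncard = 2 * p := by
  have h01 : (0 : ZMod p) ≠ 1 := zero_ne_one
  have : {q : ZMod p × ZMod p | q.1 + q.2 + k = 0 ∨ q.1 + q.2 + k = 1} =
      Set.range fun q : Bool × ZMod p => (q.2, (cond q.1 1 0 : ZMod p) - q.2 - k) := by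
    ext ⟨x, y⟩
    simp only [Set.mem_ofPred_eq, Set.mem_range, Prod.exists, Prod.mk.injEq]
    constructor
    · rintro (h | h)
      · exact ⟨false, x, rfl, by simp only [cond]; linear_combination -h⟩
      · exact ⟨true, x, rfl, by simp only [cond]; linear_combination -h⟩
    · rintro ⟨_ | _, x, rfl, rfl⟩
      · left; simp only [cond]; ring
      · right; simp only [cond]; ring
  rw [this, ← Nat.card_coe_set_eq, Nat.card_range_of_injective]
  · simp
  · rintro ⟨b, x⟩ ⟨b', x'⟩ e
    obtain ⟨e1, e2⟩ := Prod.mk.inj e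
    have e3 : (cond b 1 0 : ZMod p) = cond b' 1 0 := by linear_combination e1 + e2
    cases b <;> cases b' <;> simp_all

theorem hasSchlafliSymbol [Fact p.Prime] : HasSchlafliSymbol (BipartiteCell p) (2 * p) p := by
  constructor
  · intro F G _ hF hG
    rw [height_eq] at hF hG
    replace hF : rank F = 0 := by exact_mod_cast hF
    replace hG : rank G = 3 := by exact_mod_cast hG
    cases F <;> simp only [rank] at hF <;> try omega
    rcases G with _ | _ | _ | k | _ <;> simp only [rank] at hG <;> try omega
    rw [← ncard_edges_face k, ← Set.ncard_image_of_injective _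
      (f := fun q : ZMod p × ZMod p => edge q.1 q.2) (by rintro ⟨⟩ ⟨⟩; simp)]
    congr 1
    ext H
    simp only [Set.mem_ofPred_eq, mem_Ioo_iff, Set.mem_image, Prod.exists, height_eq]
    norm_cast
    cases H <;> simp [Incident, rank]
  · intro F G _ hF hG
    rw [height_eq] at hF hG
    replace hF : rank F = 1 := by exact_mod_cast hF
    replace hG : rank G = 4 := by exact_mod_cast hG
    rcases F with _ | ⟨e, i⟩ | _ | _ | _ <;> simp only [rank] at hF <;> try omega
    cases G <;> simp only [rank] at hG <;> try omega
    have : {H : BipartiteCell p | H ∈ Set.Ioo (vert e i) top ∧ Order.height H = 3} =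
        Set.range face := by
      ext H
      simp only [Set.mem_ofPred_eq, mem_Ioo_iff, Set.mem_range, height_eq]
      norm_cast
      cases H <;> simp [Incident, rank]
    rw [this, ← Nat.card_coe_set_eq, Nat.card_range_of_injective]
    · simp
    · intro k k'
      simp

end BipartiteCell

/-! ### Transport along order isomorphisms -/

section Transport

variable {P Q : Type*} [PartialOrder P] [PartialOrder Q]

theorem IsAbstractPolytope.of_orderIso {n : ℕ} (h : IsAbstractPolytope P n) (φ : P ≃o Q) :
    IsAbstractPolytope Q n where
  exists_bot := by
    obtain ⟨F, -, hF⟩ := h.exists_bot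
    exact ⟨φ F, trivial, fun G _ => φ.le_symm_apply.1 (hF trivial)⟩
  exists_top := by
    obtain ⟨F, -, hF⟩ := h.exists_top
    exact ⟨φ F, trivial, fun G _ => φ.symm_apply_le.1 (hF trivial)⟩
  ncard_flag Φ := by
    rw [← h.ncard_flag (Flag.map φ.symm Φ), Flag.coe_map]
    exact (Set.ncard_image_of_injective _ φ.symm.injective).symm
  connected F G hFG hr H hH K hK := by
    have := h.connected (φ.symm F) (φ.symm G) (by simpa using hFG)
      (by simpa only [Order.height_orderIso] using hr) (φ.symm H) (by simpa using hH) (φ.symm K)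
      (by simpa using hK)
    have h2 := this.lift (p := SectionStep F G) φ fun A B hAB =>
      ⟨⟨φ.symm_apply_lt.1 hAB.1.1, φ.lt_symm_apply.1 hAB.1.2⟩, by simpa using hAB.2⟩
    rwa [Function.onFun, φ.apply_symm_apply, φ.apply_symm_apply] at h2
  diamond F G hFG hr := by
    rw [← h.diamond (φ.symm F) (φ.symm G) (by simpa using hFG)
      (by simpa only [Order.height_orderIso] using hr), ← φ.symm.image_Ioo]
    exact (Set.ncard_image_of_injective _ φ.symm.injective).symm

theorem IsRegularPolytope.of_orderIso {n : ℕ} (h : IsRegularPolytope P n) (φ : P ≃o Q) :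
    IsRegularPolytope Q n := by
  refine ⟨h.1.of_orderIso φ, ⟨fun Φ Ψ => ?_⟩⟩
  obtain ⟨g, hg⟩ := h.2.exists_smul_eq (Flag.map φ.symm Φ) (Flag.map φ.symm Ψ)
  refine ⟨(φ.symm.trans g).trans φ, ?_⟩
  have hg' := congrArg (Flag.map φ) hg
  apply SetLike.coe_injective
  have h3 := congrArg (fun Φ : Flag Q => (Φ : Set Q)) hg'
  simp only [Flag.coe_map, Flag.coe_smul, ← Set.image_smul, Set.image_image] at h3 ⊢
  simpa [RelIso.smul_def] using h3

theorem HasSchlafliSymbol.of_orderIso {a b : ℕ} (h : HasSchlafliSymbol P a b) (φ : P ≃o Q) :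
    HasSchlafliSymbol Q a b := by
  have key : ∀ (F G : Q) (r : ℕ∞), {H | H ∈ Set.Ioo F G ∧ Order.height H = r}.ncard =
      {H | H ∈ Set.Ioo (φ.symm F) (φ.symm G) ∧ Order.height H = r}.ncard := by
    intro F G r
    rw [← Set.ncard_image_of_injective _ φ.symm.injective]
    congr 1
    ext H
    constructor
    · rintro ⟨K, ⟨hK, hr⟩, rfl⟩
      exact ⟨by simpa using hK, by rw [Order.height_orderIso, hr]⟩
    · rintro ⟨hK, hr⟩
      refine ⟨φ H, ⟨?_, by rw [Order.height_orderIso, hr]⟩, by simp⟩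
      exact ⟨by simpa [← φ.symm_apply_lt] using hK.1, by simpa [← φ.lt_symm_apply] using hK.2⟩
  constructor
  · intro F G hFG hF hG
    rw [key]
    exact h.1 _ _ (by simpa using hFG) (by rwa [Order.height_orderIso])
      (by rwa [Order.height_orderIso])
  · intro F G hFG hF hG
    rw [key]
    exact h.2 _ _ (by simpa using hFG) (by rwa [Order.height_orderIso])
      (by rwa [Order.height_orderIso])

end Transport

theorem not_isType1_of_isType2 {G : Type*} [Group G] {u : (complexX G).Sheet} (h : IsType2 u) :
    ¬ IsType1 u := by
  rintro ⟨x, hx⟩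
  obtain ⟨y, hy⟩ := h
  rw [hx] at hy
  simp at hy

/-! ### The cell poset of a component that has a tripartite model -/

namespace ComponentY

open Classical BipartiteCell PreAbstractSimplicialComplex

variable {G : Type*} [Group G] {p : ℕ}

/-- The triangulation of the component `T` is the tripartite model with the vertices `f c i`, and
the vertices of type 2 are those of colour 2. -/
structure IsModel (T : ComponentY G) (f : Fin 3 → ZMod p → (complexX G).Sheet) : Prop where
  tri : T.triangulation.IsTripartiteModel f
  supp : ∀ u ∈ T.supp, ∃ c i, u = f c i
  type1 : ∀ c i, c ≠ 2 → IsType1 (f c i)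
  type2 : ∀ i, IsType2 (f 2 i)

/-- The cells of the component `T` as sets of simplices. -/
def cellSet (T : ComponentY G) (f : Fin 3 → ZMod p → (complexX G).Sheet) :
    BipartiteCell p → Set (Finset (complexX G).Sheet)
  | bot => ∅
  | vert e i => {t | t ∈ T.triangulation.faces ∧ t ⊆ {f (cond e 1 0) i}}
  | edge x y => {t | t ∈ T.triangulation.faces ∧ t ⊆ {f 0 x, f 1 y}}
  | face k => {t | t ∈ T.triangulation.faces ∧ ∃ r ∈ T.triangulation.faces, f 2 k ∈ r ∧ t ⊆ r}
  | top => T.triangulation.faces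

namespace IsModel

variable {T : ComponentY G} {f : Fin 3 → ZMod p → (complexX G).Sheet}

theorem singleton_mem (h : T.IsModel f) (c : Fin 3) (i : ZMod p) :
    {f c i} ∈ T.triangulation.faces :=
  (h.tri.mem_faces_rotate c _).2 ⟨by simp, i, 0, -i, by simp⟩

theorem pair_mem (h : T.IsModel f) (x y : ZMod p) :
    {f 0 x, f 1 y} ∈ T.triangulation.faces :=
  (h.tri.mem_faces _).2 ⟨by simp, x, y, -x-y, .inl (by ring), by simp⟩

theorem index_unique (h : T.IsModel f) {r : Finset (complexX G).Sheet}
    (hr : r ∈ T.triangulation.faces) {c : Fin 3} {i j : ZMod p} (hi : f c i ∈ r)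
    (hj : f c j ∈ r) : i = j := by
  obtain ⟨-, x, y, z, -, hsub⟩ := (h.tri.mem_faces_rotate c r).1 hr
  have c1 : ∀ c : Fin 3, c ≠ c + 1 := by decide
  have c2 : ∀ c : Fin 3, c ≠ c + 2 := by decide
  have key : ∀ k, f c k ∈ r → k = x := by
    intro k hk
    have := hsub _ hk
    simp only [h.tri.eq_iff, c1, c2, false_and, or_false, true_and] at this
    exact this
  rw [key i hi, key j hj]

theorem sum_of_mem (h : T.IsModel f) {r : Finset (complexX G).Sheet}
    (hr : r ∈ T.triangulation.faces) {x y z : ZMod p} (hx : f 0 x ∈ r)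
    (hy : f 1 y ∈ r) (hz : f 2 z ∈ r) : x + y + z = 0 ∨ x + y + z = 1 := by
  obtain ⟨-, x', y', z', hs, hsub⟩ := (h.tri.mem_faces r).1 hr
  have h1 := hsub _ hx
  have h2 := hsub _ hy
  have h3 := hsub _ hz
  simp [h.tri.eq_iff] at h1 h2 h3
  rwa [h1, h2, h3]

theorem cellSet_subset_of_le (h : T.IsModel f) {a b : BipartiteCell p} (hab : Incident a b) :
    cellSet T f a ⊆ cellSet T f b := by
  rcases a with _ | ⟨e, i⟩ | ⟨x, y⟩ | k | _ <;> rcases b with _ | ⟨e', i'⟩ | ⟨x', y'⟩ | k' | _ <;>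
    simp only [Incident] at hab
  · exact Set.empty_subset _
  · exact Set.empty_subset _
  · exact Set.empty_subset _
  · exact Set.empty_subset _
  · exact Set.empty_subset _
  · rw [hab.1, hab.2]
  · rintro t ⟨ht, hs⟩
    refine ⟨ht, hs.trans ?_⟩
    subst hab
    cases e <;> simp
  · rintro t ⟨ht, hs⟩
    -- Every vertex lies on every 2-cell, since it is joined to each center `f 2 k'`.
    refine ⟨ht, {f (cond e 1 0) i, f 2 k'}, ?_, by simp, hs.trans (by simp)⟩
    rw [h.tri.mem_faces]
    cases e
    · exact ⟨by simp, i, -i-k', k', .inl (by ring), by simp⟩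
    · exact ⟨by simp, -i-k', i, k', .inl (by ring), by simp⟩
  · exact fun t ht => ht.1
  · rw [hab.1, hab.2]
  · rintro t ⟨ht, hs⟩
    refine ⟨ht, {f 0 x, f 1 y, f 2 k'}, ?_, by simp, hs.trans (by grind)⟩
    rw [h.tri.mem_faces]
    exact ⟨by simp, x, y, k', hab, by simp⟩
  · exact fun t ht => ht.1
  · rw [hab]
  · exact fun t ht => ht.1
  · exact subset_rfl

/-- Each vertex, edge or face cell is tested on one simplex: the vertex itself, the edge itself, or
the center `f 2 k` of the face. The greatest cell is tested on all centers, of which a single face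
contains only its own. -/
theorem le_of_cellSet_subset [Fact p.Prime] (h : T.IsModel f) {a b : BipartiteCell p}
    (hab : cellSet T f a ⊆ cellSet T f b) : Incident a b := by
  have hface : ∀ k, {f 2 k} ∈ cellSet T f (face k) := fun k =>
    ⟨h.singleton_mem 2 k, _, h.singleton_mem 2 k, by simp, subset_rfl⟩
  have h20 : ∀ i j, f 2 i ≠ f 0 j := fun i j => h.tri.ne_of_color_ne (by decide) i j
  have h21 : ∀ i j, f 2 i ≠ f 1 j := fun i j => h.tri.ne_of_color_ne (by decide) i j
  have h10 : ∀ i j, f 1 i ≠ f 0 j := fun i j => h.tri.ne_of_color_ne (by decide) i j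
  have f2vert : ∀ k e i, {f 2 k} ∉ cellSet T f (vert e i) := by
    rintro k e i ⟨-, hs⟩
    have := hs (Finset.mem_singleton_self _)
    cases e <;> simp [h20, h21] at this
  have f2edge : ∀ k x y, {f 2 k} ∉ cellSet T f (edge x y) := by
    rintro k x y ⟨-, hs⟩
    have := hs (Finset.mem_singleton_self _)
    simp [h20, h21] at this
  have f2face : ∀ k k', {f 2 k} ∈ cellSet T f (face k') → k = k' := by
    rintro k k' ⟨-, r, hr, hk', hs⟩
    exact h.index_unique hr (by simpa using hs) hk'
  cases a with
  | bot => trivial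
  | vert e i =>
    have h1 : {f (cond e 1 0) i} ∈ cellSet T f b := hab ⟨h.singleton_mem _ i, subset_rfl⟩
    cases b with
    | bot => exact h1
    | vert e' i' =>
      have h2 := h1.2 (Finset.mem_singleton_self _)
      rw [Finset.mem_singleton, h.tri.eq_iff] at h2
      cases e <;> cases e' <;> simp_all [Incident]
    | edge x y =>
      have h2 := h1.2 (Finset.mem_singleton_self _)
      rw [Finset.mem_insert, Finset.mem_singleton, h.tri.eq_iff, h.tri.eq_iff] at h2
      cases e <;> simp_all [Incident]
    | face k => trivial
    | top => trivial
  | edge x y =>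
    have h1 : {f 0 x, f 1 y} ∈ cellSet T f b := hab ⟨h.pair_mem x y, subset_rfl⟩
    cases b with
    | bot => exact h1
    | vert e i =>
      have h2 : f 0 x = f (cond e 1 0) i := by simpa using h1.2 (by simp : f 0 x ∈ _)
      have h3 : f 1 y = f (cond e 1 0) i := by simpa using h1.2 (by simp : f 1 y ∈ _)
      exact absurd (h3.trans h2.symm) (h10 _ _)
    | edge x' y' =>
      have h2 := h1.2 (by simp : f 0 x ∈ _)
      have h3 := h1.2 (by simp : f 1 y ∈ _)
      simp [h.tri.eq_iff] at h2 h3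
      exact ⟨h2, h3⟩
    | face k =>
      obtain ⟨-, r, hr, hk, hs⟩ := h1
      exact h.sum_of_mem hr (hs (by simp)) (hs (by simp)) hk
    | top => trivial
  | face k =>
    have h1 : {f 2 k} ∈ cellSet T f b := hab (hface k)
    cases b with
    | bot => exact h1
    | vert e i => exact f2vert _ _ _ h1
    | edge x y => exact f2edge _ _ _ h1
    | face k' => exact f2face _ _ h1
    | top => trivial
  | top =>
    have h1 : ∀ k, {f 2 k} ∈ cellSet T f b := fun k => hab (h.singleton_mem 2 k)
    cases b with
    | bot => exact h1 0
    | vert e i => exact f2vert _ _ _ (h1 0)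
    | edge x y => exact f2edge _ _ _ (h1 0)
    | face k =>
      have := f2face _ _ (h1 (k + 1))
      simp at this
    | top => trivial

/-- The cells of `T`, as an order embedding. -/
noncomputable def cellEmbedding [Fact p.Prime] (h : T.IsModel f) :
    BipartiteCell p ↪o Set (Finset (complexX G).Sheet) :=
  OrderEmbedding.ofMapLEIff (cellSet T f) fun _ _ =>
    ⟨fun hab => h.le_of_cellSet_subset hab, fun hab => h.cellSet_subset_of_le hab⟩

theorem cellSet_injective [Fact p.Prime] (h : T.IsModel f) : Function.Injective (cellSet T f) :=
  h.cellEmbedding.injective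

theorem cellSet_subset_iff [Fact p.Prime] (h : T.IsModel f) {a b : BipartiteCell p} :
    cellSet T f a ⊆ cellSet T f b ↔ Incident a b :=
  ⟨fun hab => h.le_of_cellSet_subset hab, fun hab => h.cellSet_subset_of_le hab⟩

theorem mem_triangulation_type1 (h : T.IsModel f) {s : Finset (complexX G).Sheet}
    (hs : s ∈ T.triangulation.faces) (h1 : ∀ u ∈ s, IsType1 u) :
    ∃ x y, ∀ u ∈ s, u = f 0 x ∨ u = f 1 y := by
  obtain ⟨-, x, y, z, -, hsub⟩ := (h.tri.mem_faces s).1 hs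
  refine ⟨x, y, fun u hu => ?_⟩
  rcases hsub u hu with e | e | e
  · exact .inl e
  · exact .inr e
  · exact absurd (h1 u hu) (e ▸ not_isType1_of_isType2 (h.type2 z))

theorem vertexCells_eq (h : T.IsModel f) :
    T.vertexCells = Set.range fun q : Bool × ZMod p => cellSet T f (vert q.1 q.2) := by
  ext c
  simp only [Set.mem_range, Prod.exists]
  constructor
  · rintro ⟨s, hs, hc, h1, rfl⟩
    obtain ⟨u, rfl⟩ := Finset.card_eq_one.1 hc
    obtain ⟨x, y, hxy⟩ := h.mem_triangulation_type1 hs h1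
    rcases hxy u (by simp) with rfl | rfl
    · exact ⟨false, x, rfl⟩
    · exact ⟨true, y, rfl⟩
  · rintro ⟨e, i, rfl⟩
    refine ⟨_, h.singleton_mem _ i, by simp, ?_, rfl⟩
    simp only [Finset.mem_singleton, forall_eq]
    exact h.type1 _ _ (by cases e <;> decide)

theorem edgeCells_eq (h : T.IsModel f) :
    T.edgeCells = Set.range fun q : ZMod p × ZMod p => cellSet T f (edge q.1 q.2) := by
  ext c
  simp only [Set.mem_range, Prod.exists]
  constructor
  · rintro ⟨s, hs, hc, h1, rfl⟩
    obtain ⟨u, v, huv, rfl⟩ := Finset.card_eq_two.1 hc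
    obtain ⟨x, y, hxy⟩ := h.mem_triangulation_type1 hs h1
    refine ⟨x, y, ?_⟩
    rcases hxy u (by simp) with rfl | rfl <;> rcases hxy v (by simp) with rfl | rfl
    · exact absurd rfl huv
    · rfl
    · rw [Finset.pair_comm]; rfl
    · exact absurd rfl huv
  · rintro ⟨x, y, rfl⟩
    refine ⟨_, h.pair_mem x y, Finset.card_pair (h.tri.ne_of_color_ne (by decide) _ _), ?_, rfl⟩
    simp only [Finset.mem_insert, Finset.mem_singleton, forall_eq_or_imp, forall_eq]
    exact ⟨h.type1 _ _ (by decide), h.type1 _ _ (by decide)⟩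

theorem faceCells_eq (h : T.IsModel f) :
    T.faceCells = Set.range fun k : ZMod p => cellSet T f (face k) := by
  ext c
  simp only [Set.mem_range]
  constructor
  · rintro ⟨w, hw, h2, rfl⟩
    obtain ⟨c, i, rfl⟩ := h.supp w hw
    obtain rfl : c = 2 := by
      by_contra hc
      exact not_isType1_of_isType2 h2 (h.type1 c i hc)
    exact ⟨i, rfl⟩
  · rintro ⟨k, rfl⟩
    exact ⟨f 2 k, (h.singleton_mem 2 k).2 (by simp), h.type2 k, rfl⟩

/-- The poset of the cells of `T` is the model poset. -/
theorem nonempty_orderIso [Fact p.Prime] (h : T.IsModel f) :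
    Nonempty (BipartiteCell p ≃o T.CellPoset) := by
  have hr : Set.range h.cellEmbedding = {∅} ∪ T.vertexCells ∪ T.edgeCells ∪ T.faceCells ∪
      {T.triangulation.faces} := by
    rw [h.vertexCells_eq, h.edgeCells_eq, h.faceCells_eq]
    ext c
    simp only [Set.mem_union, Set.mem_range, Set.mem_singleton_iff, Prod.exists]
    constructor
    · rintro ⟨_ | ⟨e, i⟩ | ⟨x, y⟩ | k | _, rfl⟩
      · exact .inl (.inl (.inl (.inl rfl)))
      · exact .inl (.inl (.inl (.inr ⟨e, i, rfl⟩)))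
      · exact .inl (.inl (.inr ⟨x, y, rfl⟩))
      · exact .inl (.inr ⟨k, rfl⟩)
      · exact .inr rfl
    · rintro ((((rfl | ⟨e, i, rfl⟩) | ⟨x, y, rfl⟩) | ⟨k, rfl⟩) | rfl)
      exacts [⟨bot, rfl⟩, ⟨vert e i, rfl⟩, ⟨edge x y, rfl⟩, ⟨face k, rfl⟩, ⟨top, rfl⟩]
  exact ⟨h.cellEmbedding.orderIso.trans (OrderIso.setCongr _ _ hr)⟩

theorem ncard_vertexCells [Fact p.Prime] (h : T.IsModel f) : T.vertexCells.ncard = 2 * p := by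
  rw [h.vertexCells_eq, ← Nat.card_coe_set_eq, Nat.card_range_of_injective]
  · simp
  · rintro ⟨e, i⟩ ⟨e', i'⟩ he
    simpa using h.cellSet_injective he

theorem ncard_edgeCells [Fact p.Prime] (h : T.IsModel f) : T.edgeCells.ncard = p ^ 2 := by
  rw [h.edgeCells_eq, ← Nat.card_coe_set_eq, Nat.card_range_of_injective]
  · simp [sq]
  · rintro ⟨e, i⟩ ⟨e', i'⟩ he
    simpa using h.cellSet_injective he

theorem ncard_faceCells [Fact p.Prime] (h : T.IsModel f) : T.faceCells.ncard = p := by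
  rw [h.faceCells_eq, ← Nat.card_coe_set_eq, Nat.card_range_of_injective]
  · simp
  · intro k k' he
    simpa using h.cellSet_injective he

theorem ncard_edges_of_face [Fact p.Prime] (h : T.IsModel f) :
    ∀ c ∈ T.faceCells, {e ∈ T.edgeCells | e ⊆ c}.ncard = 2 * p := by
  rw [h.faceCells_eq, h.edgeCells_eq]
  rintro _ ⟨k, rfl⟩
  rw [← ncard_edges_face k, ← Set.ncard_image_of_injective _
    (f := fun q : ZMod p × ZMod p => cellSet T f (edge q.1 q.2)) (by
      rintro ⟨e, i⟩ ⟨e', i'⟩ he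
      simpa using h.cellSet_injective he)]
  congr 1
  ext c
  constructor
  · rintro ⟨⟨q, rfl⟩, hq⟩
    exact ⟨q, h.cellSet_subset_iff.1 hq, rfl⟩
  · rintro ⟨q, hq, rfl⟩
    exact ⟨⟨q, rfl⟩, h.cellSet_subset_iff.2 hq⟩

theorem ncard_edges_of_vertex [Fact p.Prime] (h : T.IsModel f) :
    ∀ v ∈ T.vertexCells, {e ∈ T.edgeCells | v ⊆ e}.ncard = p := by
  rw [h.vertexCells_eq, h.edgeCells_eq]
  rintro _ ⟨⟨e, i⟩, rfl⟩
  have : {c ∈ Set.range fun q : ZMod p × ZMod p => cellSet T f (edge q.1 q.2) |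
      cellSet T f (vert e i) ⊆ c} =
      Set.range fun j => cellSet T f (edge (cond e j i) (cond e i j)) := by
    ext c
    constructor
    · rintro ⟨⟨⟨x, y⟩, rfl⟩, hq⟩
      have hi : i = cond e y x := h.cellSet_subset_iff.1 hq
      subst hi
      cases e
      · exact ⟨y, rfl⟩
      · exact ⟨x, rfl⟩
    · rintro ⟨j, rfl⟩
      refine ⟨⟨(_, _), rfl⟩, h.cellSet_subset_iff.2 ?_⟩
      cases e <;> rfl
  rw [this, ← Nat.card_coe_set_eq, Nat.card_range_of_injective]
  · simp
  · intro j j' he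
    have := h.cellSet_injective he
    cases e <;> simpa using this

end IsModel

end ComponentY

/-! ### Sheets in terms of noncommuting pairs -/

section GroupComplexSheets

variable {G : Type*} [Group G]

variable (G) in
/-- The ordered pairs of noncommuting elements of `G`. They correspond to the triangles of
`X(G)`. -/
abbrev NoncommutingPair : Type _ := {q : G × G // q.1 * q.2 ≠ q.2 * q.1}

namespace NoncommutingPair

/-- The vertices of the triangle of a noncommuting pair. -/
def vertex (q : NoncommutingPair G) : Fin 3 → Noncentral G ⊕ Noncentral G :=
  ![Sum.inl ⟨q.1.1, fun h => q.2 ((Subgroup.mem_center_iff.1 h q.1.2).symm)⟩,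
    Sum.inl ⟨q.1.2, fun h => q.2 (Subgroup.mem_center_iff.1 h q.1.1)⟩,
    Sum.inr ⟨q.1.1 * q.1.2, fun h => q.2 (by
      have := Subgroup.mem_center_iff.1 h q.1.1
      rw [mul_assoc] at this
      exact mul_left_cancel this)⟩]

theorem vertex_injective (q : NoncommutingPair G) : Function.Injective q.vertex := by
  have h : q.1.1 ≠ q.1.2 := fun h => q.2 (by rw [h])
  intro c d hcd
  fin_cases c <;> fin_cases d <;> simp_all [vertex]

open Classical in
/-- The triangle of a noncommuting pair. -/
noncomputable def triangle (q : NoncommutingPair G) : Finset (Noncentral G ⊕ Noncentral G) :=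
  Finset.univ.image q.vertex

theorem mem_triangle {q : NoncommutingPair G} {v : Noncentral G ⊕ Noncentral G} :
    v ∈ q.triangle ↔ ∃ c, q.vertex c = v := by
  simp [triangle]

theorem card_triangle (q : NoncommutingPair G) : q.triangle.card = 3 := by
  classical
  rw [triangle, Finset.card_image_of_injective _ q.vertex_injective]
  rfl

theorem coe_triangle (q : NoncommutingPair G) :
    (q.triangle : Set (Noncentral G ⊕ Noncentral G)) = {q.vertex 0, q.vertex 1, q.vertex 2} := by
  ext v
  simp only [Finset.mem_coe, mem_triangle, Fin.exists_fin_succ, Set.mem_insert_iff,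
    Set.mem_singleton_iff, eq_comm (a := v)]
  simp

theorem mem_faces_iff {s : Finset (Noncentral G ⊕ Noncentral G)} :
    s ∈ (complexX G).faces ↔ s.Nonempty ∧ ∃ q : NoncommutingPair G, s ⊆ q.triangle := by
  refine and_congr_right fun _ => ?_
  constructor
  · rintro ⟨x, y, z, h, hz, hs⟩
    obtain ⟨z, hzc⟩ := z
    dsimp only at hz
    subst hz
    refine ⟨⟨(x, y), h⟩, ?_⟩
    rw [← Finset.coe_subset, coe_triangle]
    exact hs
  · rintro ⟨q, hs⟩
    rw [← Finset.coe_subset, coe_triangle] at hs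
    exact ⟨_, _, _, q.2, rfl, hs⟩

/-- The corner of the triangle of a noncommuting pair at its vertex with index `c`. -/
noncomputable def corner (q : NoncommutingPair G) (c : Fin 3) : (complexX G).Corner where
  tri := q.triangle
  pt := q.vertex c
  tri_mem := mem_faces_iff.2 ⟨⟨q.vertex c, mem_triangle.2 ⟨c, rfl⟩⟩, q, subset_rfl⟩
  card_tri := q.card_triangle
  pt_mem := mem_triangle.2 ⟨c, rfl⟩

theorem exists_triangle_eq (k : (complexX G).Corner) : ∃ q : NoncommutingPair G,
    k.tri = q.triangle := by
  obtain ⟨-, q, hq⟩ := mem_faces_iff.1 k.tri_mem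
  exact ⟨q, Finset.eq_of_subset_of_card_le hq (by rw [k.card_tri, q.card_triangle])⟩

theorem exists_corner_eq (k : (complexX G).Corner) {q : NoncommutingPair G}
    (h : k.tri = q.triangle) : ∃ c, k = q.corner c := by
  obtain ⟨tri, pt, h1, h2, h3⟩ := k
  dsimp only at h
  subst h
  obtain ⟨c, rfl⟩ := mem_triangle.1 h3
  exact ⟨c, rfl⟩

/-- The sheet of the triangle of a noncommuting pair at its vertex with index `c`. -/
noncomputable def sheet (q : NoncommutingPair G) (c : Fin 3) : (complexX G).Sheet :=
  Quot.mk _ (q.corner c)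

theorem exists_sheet_eq (u : (complexX G).Sheet) : ∃ (q : NoncommutingPair G) (c : Fin 3),
    u = q.sheet c := by
  induction u using Quot.ind with
  | mk k =>
    obtain ⟨q, hq⟩ := exists_triangle_eq k
    obtain ⟨c, rfl⟩ := exists_corner_eq k hq
    exact ⟨q, c, rfl⟩

theorem mem_complexY_iff {s : Finset (complexX G).Sheet} :
    s ∈ (complexY G).faces ↔ s.Nonempty ∧ ∃ q : NoncommutingPair G, ∀ u ∈ s, ∃ c,
      u = q.sheet c := by
  constructor
  · rintro ⟨⟨v, hv⟩, σ, hσ⟩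
    obtain ⟨k, hk, -⟩ := hσ v hv
    obtain ⟨q, hq⟩ := exists_triangle_eq k
    refine ⟨⟨v, hv⟩, q, fun u hu => ?_⟩
    obtain ⟨k', hk', rfl⟩ := hσ u hu
    obtain ⟨c, rfl⟩ := exists_corner_eq k' (hk'.trans (hk.symm.trans hq))
    exact ⟨c, rfl⟩
  · rintro ⟨hs, q, hq⟩
    refine ⟨hs, q.triangle, fun u hu => ?_⟩
    obtain ⟨c, rfl⟩ := hq u hu
    exact ⟨q.corner c, rfl, rfl⟩

open Classical in
/-- Triangles with a common edge define the same sheets at the vertices of this edge. -/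
theorem sheet_eq_of_vertex_eq {q q' : NoncommutingPair G} {c d c' d' : Fin 3} (hcd : c ≠ d)
    (hc : q.vertex c = q'.vertex c') (hd : q.vertex d = q'.vertex d') :
    q.sheet c = q'.sheet c' := by
  have hsub : {q.vertex c, q.vertex d} ⊆ q.triangle := by
    simp [Finset.insert_subset_iff, mem_triangle]
  refine Quot.sound ⟨hc, {q.vertex c, q.vertex d}, mem_faces_iff.2 ⟨by simp, q, hsub⟩,
    Finset.card_pair (q.vertex_injective.ne hcd), by simp [corner], hsub, ?_⟩
  rw [hc, hd]
  simp [corner, Finset.insert_subset_iff, mem_triangle]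

/-- The pair in the opposite order. -/
def flip (q : NoncommutingPair G) : NoncommutingPair G := ⟨(q.1.2, q.1.1), q.2.symm⟩

theorem sheet_zero_eq_flip (q : NoncommutingPair G) : q.sheet 0 = q.flip.sheet 1 :=
  sheet_eq_of_vertex_eq (d := 1) (d' := 0) (by decide) rfl rfl

theorem sheet_one_eq_flip (q : NoncommutingPair G) : q.sheet 1 = q.flip.sheet 0 :=
  sheet_eq_of_vertex_eq (d := 0) (d' := 1) (by decide) rfl rfl

/-- If `x * y = z * x`, the triangles of `(x, y)` and `(z, x)` have two vertices in common. -/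
theorem sheet_zero_eq_one {q q' : NoncommutingPair G} (h : q.1.1 = q'.1.2)
    (hm : q.1.1 * q.1.2 = q'.1.1 * q'.1.2) : q.sheet 0 = q'.sheet 1 :=
  sheet_eq_of_vertex_eq (d := 2) (d' := 2) (by decide) (congrArg Sum.inl (Subtype.ext h))
    (congrArg Sum.inr (Subtype.ext hm))

/-- The common edge is the one of `sheet_zero_eq_one`, now seen from its type 2 end. -/
theorem sheet_two_eq_two {q q' : NoncommutingPair G} (h : q.1.1 = q'.1.2)
    (hm : q.1.1 * q.1.2 = q'.1.1 * q'.1.2) : q.sheet 2 = q'.sheet 2 :=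
  sheet_eq_of_vertex_eq (d := 0) (d' := 1) (by decide) (congrArg Sum.inr (Subtype.ext hm))
    (congrArg Sum.inl (Subtype.ext h))

end NoncommutingPair

/-! ### Central cosets as an invariant, and the indexing of a component -/

/-- `ζ` parametrizes the center of `G` by `ZMod p`, and all commutators are central. -/
structure IsCentralParam {p : ℕ} (ζ : ZMod p → G) : Prop where
  add : ∀ s t, ζ (s + t) = ζ s * ζ t
  inj : Function.Injective ζ
  mem_center : ∀ g, g ∈ Subgroup.center G ↔ ∃ t, g = ζ t
  comm : ∀ x y, ∃ d, x * y = y * x * ζ d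

namespace IsCentralParam

open NoncommutingPair

variable {p : ℕ} {ζ : ZMod p → G}

theorem commute (hζ : IsCentralParam ζ) (t : ZMod p) (g : G) : ζ t * g = g * ζ t :=
  (Subgroup.mem_center_iff.1 ((hζ.mem_center _).2 ⟨t, rfl⟩) g).symm

theorem zero (hζ : IsCentralParam ζ) : ζ 0 = 1 := by
  have := hζ.add 0 0
  simpa using this

theorem mul_mul_mul (hζ : IsCentralParam ζ) (x y : G) (s t : ZMod p) :
    x * ζ s * (y * ζ t) = x * y * ζ (s + t) := by
  rw [mul_assoc, ← mul_assoc (ζ s), hζ.commute, hζ.add]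
  simp only [mul_assoc]

/-- The image of a pair under multiplication by central elements. -/
def translate (hζ : IsCentralParam ζ) (q : NoncommutingPair G) (s t : ZMod p) :
    NoncommutingPair G :=
  ⟨(q.1.1 * ζ s, q.1.2 * ζ t), by
    dsimp only
    rw [hζ.mul_mul_mul, hζ.mul_mul_mul, add_comm t s]
    exact fun h => q.2 (mul_right_cancel h)⟩

/-- The images of the elements of the pair in the central quotient. -/
def classes (σ : Finset (Noncentral G ⊕ Noncentral G)) : Set (G ⧸ Subgroup.center G) :=
  {a | ∃ x : Noncentral G, Sum.inl x ∈ σ ∧ a = (x : G)}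

theorem classes_triangle (q : NoncommutingPair G) :
    classes q.triangle = {(q.1.1 : G ⧸ Subgroup.center G), (q.1.2 : G ⧸ Subgroup.center G)} := by
  ext a
  simp only [classes, mem_triangle, Fin.exists_fin_succ, vertex]
  constructor
  · rintro ⟨x, h, rfl⟩
    simp at h
    rcases h with rfl | rfl <;> simp
  · rintro (rfl | rfl)
    · exact ⟨⟨q.1.1, _⟩, .inl rfl, rfl⟩
    · exact ⟨⟨q.1.2, _⟩, .inr (.inl rfl), rfl⟩

theorem quotient_comm (hζ : IsCentralParam ζ) (a b : G ⧸ Subgroup.center G) : a * b = b * a := by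
  induction a using QuotientGroup.induction_on with | H a => ?_
  induction b using QuotientGroup.induction_on with | H b => ?_
  obtain ⟨d, hd⟩ := hζ.comm a b
  rw [← QuotientGroup.mk_mul, ← QuotientGroup.mk_mul, eq_comm, QuotientGroup.eq]
  rw [hd, inv_mul_cancel_left]
  exact (hζ.mem_center _).2 ⟨d, rfl⟩

theorem class_eq_of_vertex_eq {q q' : NoncommutingPair G} {c c' : Fin 3}
    (h : q.vertex c = q'.vertex c') : (c = 2 ↔ c' = 2) ∧
      ![(q.1.1 : G ⧸ Subgroup.center G), q.1.2, q.1.1 * q.1.2] c =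
        ![(q'.1.1 : G ⧸ Subgroup.center G), q'.1.2, q'.1.1 * q'.1.2] c' := by
  fin_cases c <;> fin_cases c' <;> simp_all [vertex, ← QuotientGroup.mk_mul]

/-- In the abelian quotient, an edge between type 1 vertices shows both cosets; any other edge shows
one coset and the product, whence the other coset by cancellation, in whichever order the factors
occur. -/
theorem classes_eq_of_edge (hζ : IsCentralParam ζ) {q q' : NoncommutingPair G}
    {e : Finset (Noncentral G ⊕ Noncentral G)} (he : e.card = 2) (h : e ⊆ q.triangle)
    (h' : e ⊆ q'.triangle) : classes q.triangle = classes q'.triangle := by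
  classical
  obtain ⟨a, b, hab, rfl⟩ := Finset.card_eq_two.1 he
  obtain ⟨c, rfl⟩ := mem_triangle.1 (h (by simp : a ∈ _))
  obtain ⟨d, rfl⟩ := mem_triangle.1 (h (by simp : b ∈ _))
  obtain ⟨c', hc'⟩ := mem_triangle.1 (h' (by simp : q.vertex c ∈ _))
  obtain ⟨d', hd'⟩ := mem_triangle.1 (h' (by simp : q.vertex d ∈ _))
  have hcd : c ≠ d := fun e => hab (by rw [e])
  have hcd' : c' ≠ d' := fun e => hab (by rw [← hc', ← hd', e])
  obtain ⟨h1, h2⟩ := class_eq_of_vertex_eq hc'.symm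
  obtain ⟨h3, h4⟩ := class_eq_of_vertex_eq hd'.symm
  rw [classes_triangle, classes_triangle, Set.pair_eq_pair_iff]
  clear hc' hd' hab h h' he
  revert h2 h4
  generalize (q.1.1 : G ⧸ Subgroup.center G) = x, (q.1.2 : G ⧸ Subgroup.center G) = y,
    (q'.1.1 : G ⧸ Subgroup.center G) = x', (q'.1.2 : G ⧸ Subgroup.center G) = y'
  intro h2 h4
  have k1 : x * y = x' * y' → x = x' → y = y' := fun h e => by
    rw [e] at h; exact mul_left_cancel h
  have k2 : x * y = x' * y' → x = y' → y = x' := fun h e => by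
    rw [e, hζ.quotient_comm x'] at h; exact mul_left_cancel h
  have k3 : x * y = x' * y' → y = x' → x = y' := fun h e => by
    rw [e, hζ.quotient_comm x'] at h; exact mul_right_cancel h
  have k4 : x * y = x' * y' → y = y' → x = x' := fun h e => by
    rw [e] at h; exact mul_right_cancel h
  fin_cases c <;> fin_cases d <;> simp at hcd h1 h3 h2 h4 <;>
    fin_cases c' <;> fin_cases d' <;> simp at hcd' h1 h3 h2 h4 <;> tauto

/-- The classes of a sheet: all triangles of a sheet have the same classes. -/
def sheetClasses (hζ : IsCentralParam ζ) : (complexX G).Sheet → Set (G ⧸ Subgroup.center G) :=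
  Quot.lift (fun k => classes k.tri) (by
    rintro k k' ⟨-, e, -, he, -, h, h'⟩
    obtain ⟨q, hq⟩ := exists_triangle_eq k
    obtain ⟨q', hq'⟩ := exists_triangle_eq k'
    rw [hq, hq']
    exact hζ.classes_eq_of_edge he (hq ▸ h) (hq' ▸ h'))

theorem sheetClasses_sheet (hζ : IsCentralParam ζ) (q : NoncommutingPair G) (c : Fin 3) :
    hζ.sheetClasses (q.sheet c) =
      {(q.1.1 : G ⧸ Subgroup.center G), (q.1.2 : G ⧸ Subgroup.center G)} :=
  classes_triangle q

theorem exists_mul_of_mk_eq (hζ : IsCentralParam ζ) {a b : G}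
    (h : (a : G ⧸ Subgroup.center G) = b) : ∃ t, b = a * ζ t := by
  obtain ⟨t, ht⟩ := (hζ.mem_center _).1 (QuotientGroup.eq.1 h)
  exact ⟨t, by rw [← ht, mul_inv_cancel_left]⟩

/-- Pairs with the same classes differ by a central translation, up to their order. -/
theorem exists_translate (hζ : IsCentralParam ζ) {q q' : NoncommutingPair G} {c c' : Fin 3}
    (h : hζ.sheetClasses (q.sheet c) = hζ.sheetClasses (q'.sheet c')) :
    ∃ s t, q' = hζ.translate q s t ∨ q' = (hζ.translate q s t).flip := by
  rw [sheetClasses_sheet, sheetClasses_sheet, Set.pair_eq_pair_iff] at h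
  rcases h with ⟨h1, h2⟩ | ⟨h1, h2⟩
  · obtain ⟨s, hs⟩ := hζ.exists_mul_of_mk_eq h1
    obtain ⟨t, ht⟩ := hζ.exists_mul_of_mk_eq h2
    exact ⟨s, t, .inl (Subtype.ext (Prod.ext hs ht))⟩
  · obtain ⟨s, hs⟩ := hζ.exists_mul_of_mk_eq h1
    obtain ⟨t, ht⟩ := hζ.exists_mul_of_mk_eq h2
    exact ⟨s, t, .inr (Subtype.ext (Prod.ext ht hs))⟩

/-- All sheets of a component have the same classes. -/
theorem sheetClasses_eq_of_reachable (hζ : IsCentralParam ζ) {u v : (complexX G).Sheet}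
    (h : (complexY G).oneSkeleton.Reachable u v) : hζ.sheetClasses u = hζ.sheetClasses v := by
  obtain ⟨w⟩ := h
  induction w with
  | nil => rfl
  | cons hadj _ ih =>
    rw [← ih]
    obtain ⟨-, s, hs, hu, hv⟩ := hadj
    obtain ⟨-, q, hq⟩ := mem_complexY_iff.1 hs
    obtain ⟨c, rfl⟩ := hq _ hu
    obtain ⟨d, rfl⟩ := hq _ hv
    rw [sheetClasses_sheet, sheetClasses_sheet]

/-- The commutator of a pair. -/
noncomputable def commutator (hζ : IsCentralParam ζ) (q : NoncommutingPair G) : ZMod p :=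
  (hζ.comm q.1.1 q.1.2).choose

theorem mul_eq (hζ : IsCentralParam ζ) (q : NoncommutingPair G) :
    q.1.1 * q.1.2 = q.1.2 * q.1.1 * ζ (hζ.commutator q) :=
  (hζ.comm q.1.1 q.1.2).choose_spec

theorem commutator_ne_zero (hζ : IsCentralParam ζ) (q : NoncommutingPair G) :
    hζ.commutator q ≠ 0 := fun h => q.2 (by rw [hζ.mul_eq, h, hζ.zero, mul_one])

/-- The vertices of the component of a pair. -/
noncomputable def modelVertex (hζ : IsCentralParam ζ) (q : NoncommutingPair G) :
    Fin 3 → ZMod p → (complexX G).Sheet :=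
  ![fun i => (hζ.translate q (i * hζ.commutator q) 0).sheet 0,
    fun j => (hζ.translate q 0 (j * hζ.commutator q)).sheet 1,
    fun k => (hζ.translate q 0 (-k * hζ.commutator q)).sheet 2]

/-- The pair with the indices `i` and `j` in the component of `q`. -/
noncomputable def modelPair (hζ : IsCentralParam ζ) (q : NoncommutingPair G) (i j : ZMod p) :
    NoncommutingPair G :=
  hζ.translate q (i * hζ.commutator q) (j * hζ.commutator q)

theorem modelPair_mul (hζ : IsCentralParam ζ) (q : NoncommutingPair G) (i j : ZMod p) :
    (hζ.modelPair q i j).1.1 * (hζ.modelPair q i j).1.2 =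
      q.1.1 * q.1.2 * ζ ((i + j) * hζ.commutator q) := by
  rw [modelPair, translate, hζ.mul_mul_mul, add_mul]

/-- Reversing a pair costs one commutator. Scaling the indices by the commutator makes this a shift
by exactly `1`, the source of the two sums `0` and `1`. -/
theorem modelPair_flip_mul (hζ : IsCentralParam ζ) (q : NoncommutingPair G) (i j : ZMod p) :
    (hζ.modelPair q i j).flip.1.1 * (hζ.modelPair q i j).flip.1.2 =
      q.1.1 * q.1.2 * ζ ((i + j - 1) * hζ.commutator q) := by
  rw [modelPair, translate, NoncommutingPair.flip, hζ.mul_mul_mul, hζ.mul_eq q,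
    mul_assoc _ (ζ _), ← hζ.add]
  congr 2
  ring

/-- Raising `j` by one and reversing the pair leaves the product unchanged, so the triangles of `(i,
j)` and of the reversed `(i, j + 1)` share an edge at the vertex with index `i`. Reversing back
crosses another edge at this vertex. -/
theorem modelPair_sheet_zero (hζ : IsCentralParam ζ) [NeZero p] (q : NoncommutingPair G)
    (i j : ZMod p) : (hζ.modelPair q i j).sheet 0 = hζ.modelVertex q 0 i := by
  induction j using ZMod.induction_add_one with
  | h0 => simp [modelVertex, modelPair]
  | h1 j ih =>
    rw [← ih, sheet_zero_eq_flip, eq_comm]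
    refine sheet_zero_eq_one rfl ?_
    rw [modelPair_mul, modelPair_flip_mul]
    congr 3
    ring

theorem modelPair_sheet_one (hζ : IsCentralParam ζ) [NeZero p] (q : NoncommutingPair G)
    (i j : ZMod p) : (hζ.modelPair q i j).sheet 1 = hζ.modelVertex q 1 j := by
  induction i using ZMod.induction_add_one with
  | h0 => simp [modelVertex, modelPair]
  | h1 i ih =>
    rw [← ih, sheet_one_eq_flip]
    refine sheet_zero_eq_one rfl ?_
    rw [modelPair_mul, modelPair_flip_mul]
    congr 3
    ring

theorem modelPair_flip_sheet_two (hζ : IsCentralParam ζ) (q : NoncommutingPair G)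
    (i j : ZMod p) : (hζ.modelPair q (i + 1) j).flip.sheet 2 = (hζ.modelPair q i j).sheet 2 := by
  refine sheet_two_eq_two rfl ?_
  rw [modelPair_mul, modelPair_flip_mul]
  congr 3
  ring

/-- The sheet at the product passes from `(i, j + 1)` through the reversed pair `(i + 1, j + 1)` to
`(i + 1, j)`; all three have the same product. So only `i + j` matters. -/
theorem modelPair_sheet_two (hζ : IsCentralParam ζ) [NeZero p] (q : NoncommutingPair G)
    (i j : ZMod p) : (hζ.modelPair q i j).sheet 2 = hζ.modelVertex q 2 (-(i + j)) := by
  induction i using ZMod.induction_add_one generalizing j with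
  | h0 => simp [modelVertex, modelPair]
  | h1 i ih =>
    rw [show i + 1 + j = i + (j + 1) by ring, ← ih,
      ← hζ.modelPair_flip_sheet_two q i (j + 1)]
    refine sheet_two_eq_two rfl ?_
    rw [modelPair_mul, modelPair_flip_mul]
    congr 3
    ring

theorem modelPair_sheet (hζ : IsCentralParam ζ) [NeZero p] (q : NoncommutingPair G)
    (i j : ZMod p) (c : Fin 3) :
    (hζ.modelPair q i j).sheet c = hζ.modelVertex q c (![i, j, -(i + j)] c) := by
  fin_cases c
  · exact hζ.modelPair_sheet_zero q i j
  · exact hζ.modelPair_sheet_one q i j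
  · exact hζ.modelPair_sheet_two q i j

theorem modelPair_flip_sheet (hζ : IsCentralParam ζ) [NeZero p] (q : NoncommutingPair G)
    (i j : ZMod p) (c : Fin 3) : (hζ.modelPair q i j).flip.sheet c =
      hζ.modelVertex q (![1, 0, 2] c) (![j, i, 1 - (i + j)] c) := by
  fin_cases c
  · change (hζ.modelPair q i j).flip.sheet 0 = hζ.modelVertex q 1 j
    rw [← sheet_one_eq_flip, modelPair_sheet_one]
  · change (hζ.modelPair q i j).flip.sheet 1 = hζ.modelVertex q 0 i
    rw [← sheet_zero_eq_flip, modelPair_sheet_zero]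
  · change (hζ.modelPair q i j).flip.sheet 2 = hζ.modelVertex q 2 (1 - (i + j))
    have := hζ.modelPair_flip_sheet_two q (i - 1) j
    rw [sub_add_cancel] at this
    rw [this, modelPair_sheet_two]
    congr 1
    ring

end IsCentralParam

end GroupComplexSheets

/-! ### Components are tripartite models -/

section ComponentModels

open NoncommutingPair

variable {G : Type*} [Group G] {p : ℕ} {ζ : ZMod p → G}

namespace IsCentralParam

variable [Fact p.Prime]

theorem mul_commutator_injective (hζ : IsCentralParam ζ) (q : NoncommutingPair G) (g : G) :
    Function.Injective fun i => g * ζ (i * hζ.commutator q) := fun _ _ h =>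
  mul_right_cancel₀ (hζ.commutator_ne_zero q) (hζ.inj (mul_left_cancel h))

/-- The base vertices in `X(G)` already differ: the commutator is invertible mod `p`, and `x ζ(s) =
y ζ(t)` would make `x` and `y` commute. -/
theorem modelVertex_injective (hζ : IsCentralParam ζ) (q : NoncommutingPair G) (c d : Fin 3)
    (i j : ZMod p) (h : hζ.modelVertex q c i = hζ.modelVertex q d j) : c = d ∧ i = j := by
  have hne : ∀ s t, q.1.1 * ζ s ≠ q.1.2 * ζ t := by
    intro s t e
    have h1 : q.1.1 = q.1.2 * ζ (t - s) := by
      rw [sub_eq_add_neg, hζ.add, ← mul_assoc, ← e, mul_assoc, ← hζ.add, add_neg_cancel, hζ.zero,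
        mul_one]
    apply q.2
    rw [h1, mul_assoc, hζ.commute]
  have hb := congrArg PreAbstractSimplicialComplex.Sheet.base h
  fin_cases c <;> fin_cases d
  · exact ⟨rfl, hζ.mul_commutator_injective q q.1.1 (congrArg Subtype.val (Sum.inl.inj hb))⟩
  · exact absurd (congrArg Subtype.val (Sum.inl.inj hb)) (hne _ _)
  · cases hb
  · exact absurd (congrArg Subtype.val (Sum.inl.inj hb)).symm (hne _ _)
  · exact ⟨rfl, hζ.mul_commutator_injective q q.1.2 (congrArg Subtype.val (Sum.inl.inj hb))⟩
  · cases hb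
  · cases hb
  · cases hb
  · refine ⟨rfl, ?_⟩
    have h1 := congrArg Subtype.val (Sum.inr.inj hb)
    dsimp only [translate] at h1
    rw [hζ.mul_mul_mul, hζ.mul_mul_mul, zero_add, zero_add] at h1
    exact neg_injective (hζ.mul_commutator_injective q _ h1)

/-- Since `p` is prime, the nonzero commutator generates `ZMod p`, so the indexed pairs exhaust all
central translates. -/
theorem translate_eq_modelPair (hζ : IsCentralParam ζ) (q : NoncommutingPair G) (s t : ZMod p) :
    hζ.translate q s t =
      hζ.modelPair q (s * (hζ.commutator q)⁻¹) (t * (hζ.commutator q)⁻¹) := by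
  have := hζ.commutator_ne_zero q
  rw [modelPair, inv_mul_cancel_right₀ this, inv_mul_cancel_right₀ this]

theorem modelPair_zero (hζ : IsCentralParam ζ) (q : NoncommutingPair G) :
    hζ.modelPair q 0 0 = q := by
  apply Subtype.ext
  simp [modelPair, translate, hζ.zero]

theorem sheet_eq_modelVertex (hζ : IsCentralParam ζ) (q : NoncommutingPair G) (c : Fin 3) :
    q.sheet c = hζ.modelVertex q c 0 := by
  conv_lhs => rw [← hζ.modelPair_zero q, modelPair_sheet]
  congr 1
  fin_cases c <;> simp

open Classical in
theorem adj_modelVertex (hζ : IsCentralParam ζ) (q : NoncommutingPair G) {c d : Fin 3}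
    (hcd : c ≠ d) (i j : ZMod p) :
    (complexY G).oneSkeleton.Adj (hζ.modelVertex q c i) (hζ.modelVertex q d j) := by
  -- Two prescribed indices of different colours always occur in a triangle of sum `0`.
  obtain ⟨x, y, hx, hy⟩ : ∃ x y : ZMod p, i = ![x, y, -(x + y)] c ∧ j = ![x, y, -(x + y)] d := by
    fin_cases c <;> fin_cases d
    · exact absurd rfl hcd
    · exact ⟨i, j, rfl, rfl⟩
    · exact ⟨i, -i - j, rfl, by simp⟩
    · exact ⟨j, i, rfl, rfl⟩
    · exact absurd rfl hcd
    · exact ⟨-i - j, i, rfl, by simp⟩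
    · exact ⟨j, -i - j, by simp, rfl⟩
    · exact ⟨-i - j, j, by simp, rfl⟩
    · exact absurd rfl hcd
  refine ⟨fun e => hcd (hζ.modelVertex_injective q _ _ _ _ e).1,
    {hζ.modelVertex q c i, hζ.modelVertex q d j}, mem_complexY_iff.2
      ⟨by simp, hζ.modelPair q x y, ?_⟩, by simp, by simp⟩
  intro u hu
  rcases Finset.mem_insert.1 hu with rfl | hu
  · exact ⟨c, by rw [modelPair_sheet, hx]⟩
  · exact ⟨d, by rw [modelPair_sheet, ← hy, Finset.mem_singleton.1 hu]⟩

theorem reachable_modelVertex (hζ : IsCentralParam ζ) (q : NoncommutingPair G) (c d : Fin 3)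
    (i j : ZMod p) :
    (complexY G).oneSkeleton.Reachable (hζ.modelVertex q c i) (hζ.modelVertex q d j) := by
  by_cases hcd : c = d
  · subst hcd
    have hc : c ≠ c + 1 := by revert c; decide
    exact (hζ.adj_modelVertex q hc i 0).reachable.trans
      (hζ.adj_modelVertex q hc.symm 0 j).reachable
  · exact (hζ.adj_modelVertex q hcd i j).reachable

/-- The component of the triangle of a pair. -/
noncomputable def component (q : NoncommutingPair G) : ComponentY G :=
  (complexY G).oneSkeleton.connectedComponentMk (q.sheet 0)

theorem mem_supp_component (hζ : IsCentralParam ζ) (q : NoncommutingPair G)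
    (u : (complexX G).Sheet) :
    u ∈ (component q).supp ↔ ∃ c i, u = hζ.modelVertex q c i := by
  rw [SimpleGraph.ConnectedComponent.mem_supp_iff, component, SimpleGraph.ConnectedComponent.eq]
  constructor
  · intro h
    -- The coset invariant bounds the component from above; the indexed pairs and their reversals
    -- are all that it allows.
    have hcl := hζ.sheetClasses_eq_of_reachable h
    obtain ⟨q', c, rfl⟩ := exists_sheet_eq u
    obtain ⟨s, t, h' | h'⟩ := hζ.exists_translate hcl.symm
    · rw [h', translate_eq_modelPair, modelPair_sheet]
      exact ⟨_, _, rfl⟩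
    · rw [h', translate_eq_modelPair, modelPair_flip_sheet]
      exact ⟨_, _, rfl⟩
  · rintro ⟨c, i, rfl⟩
    rw [hζ.sheet_eq_modelVertex q]
    exact hζ.reachable_modelVertex q _ _ _ _

theorem sheet_mem_supp_component_iff (hζ : IsCentralParam ζ) (q q' : NoncommutingPair G)
    (c : Fin 3) : q'.sheet c ∈ (component q).supp ↔
      ∃ x y, q' = hζ.modelPair q x y ∨ q' = (hζ.modelPair q x y).flip := by
  constructor
  · intro h
    rw [SimpleGraph.ConnectedComponent.mem_supp_iff, component,
      SimpleGraph.ConnectedComponent.eq] at h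
    obtain ⟨s, t, h'⟩ := hζ.exists_translate (hζ.sheetClasses_eq_of_reachable h).symm
    rw [translate_eq_modelPair] at h'
    exact ⟨_, _, h'⟩
  · rw [hζ.mem_supp_component]
    rintro ⟨x, y, rfl | rfl⟩
    · rw [modelPair_sheet]
      exact ⟨_, _, rfl⟩
    · rw [modelPair_flip_sheet]
      exact ⟨_, _, rfl⟩

theorem isModel_component (hζ : IsCentralParam ζ) (q : NoncommutingPair G) :
    (component q).IsModel (hζ.modelVertex q) where
  tri := by
    refine ⟨hζ.modelVertex_injective q, fun s => ?_⟩
    change s ∈ (complexY G).faces ∧ (s : Set (complexX G).Sheet) ⊆ (component q).supp ↔ _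
    rw [mem_complexY_iff, and_assoc]
    refine and_congr_right fun hne => ?_
    constructor
    · rintro ⟨⟨q', hq'⟩, hs⟩
      obtain ⟨v, hv⟩ := hne
      obtain ⟨c, rfl⟩ := hq' v hv
      obtain ⟨x, y, rfl | rfl⟩ := (hζ.sheet_mem_supp_component_iff q q' c).1 (hs hv)
      · refine ⟨x, y, -(x + y), .inl (by ring), fun u hu => ?_⟩
        obtain ⟨d, rfl⟩ := hq' u hu
        rw [modelPair_sheet]
        fin_cases d
        exacts [.inl rfl, .inr (.inl rfl), .inr (.inr rfl)]
      · refine ⟨x, y, 1 - (x + y), .inr (by ring), fun u hu => ?_⟩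
        obtain ⟨d, rfl⟩ := hq' u hu
        rw [modelPair_flip_sheet]
        fin_cases d
        exacts [.inr (.inl rfl), .inl rfl, .inr (.inr rfl)]
    · rintro ⟨x, y, z, hsum, hs⟩
      refine ⟨?_, fun u hu => ?_⟩
      · rcases hsum with hsum | hsum
        · obtain rfl : z = -(x + y) := by linear_combination hsum
          refine ⟨hζ.modelPair q x y, fun u hu => ?_⟩
          rcases hs u hu with rfl | rfl | rfl
          · exact ⟨0, (hζ.modelPair_sheet q x y 0).symm⟩
          · exact ⟨1, (hζ.modelPair_sheet q x y 1).symm⟩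
          · exact ⟨2, (hζ.modelPair_sheet q x y 2).symm⟩
        · obtain rfl : z = 1 - (x + y) := by linear_combination hsum
          refine ⟨(hζ.modelPair q x y).flip, fun u hu => ?_⟩
          rcases hs u hu with rfl | rfl | rfl
          · exact ⟨1, (hζ.modelPair_flip_sheet q x y 1).symm⟩
          · exact ⟨0, (hζ.modelPair_flip_sheet q x y 0).symm⟩
          · exact ⟨2, (hζ.modelPair_flip_sheet q x y 2).symm⟩
      · rw [hζ.mem_supp_component]
        rcases hs u hu with rfl | rfl | rfl
        exacts [⟨_, _, rfl⟩, ⟨_, _, rfl⟩, ⟨_, _, rfl⟩]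
  supp u hu := (hζ.mem_supp_component q u).1 hu
  type1 c i hc := by
    fin_cases c
    · exact ⟨_, rfl⟩
    · exact ⟨_, rfl⟩
    · exact absurd rfl hc
  type2 _ := ⟨_, rfl⟩

theorem component_surjective (hζ : IsCentralParam ζ) :
    Function.Surjective (component : NoncommutingPair G → ComponentY G) := by
  intro T
  induction T using SimpleGraph.ConnectedComponent.ind with | h u => ?_
  obtain ⟨q, c, rfl⟩ := exists_sheet_eq u
  refine ⟨q, SimpleGraph.ConnectedComponent.eq.2 ?_⟩
  rw [hζ.sheet_eq_modelVertex q, hζ.sheet_eq_modelVertex q]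
  exact hζ.reachable_modelVertex q _ _ _ _

theorem exists_isModel (hζ : IsCentralParam ζ) (T : ComponentY G) :
    ∃ f : Fin 3 → ZMod p → (complexX G).Sheet, T.IsModel f := by
  obtain ⟨q, rfl⟩ := hζ.component_surjective T
  exact ⟨_, hζ.isModel_component q⟩

/-- The pairs of a component are the `p²` pairs with indices `(i, j)` and their reversals; the
sheets at their corners tell them apart. -/
theorem card_fiber (hζ : IsCentralParam ζ) (T : ComponentY G) :
    Nat.card {q : NoncommutingPair G // component q = T} = 2 * p ^ 2 := by
  obtain ⟨q, rfl⟩ := hζ.component_surjective T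
  let φ : Bool × ZMod p × ZMod p → NoncommutingPair G := fun r =>
    cond r.1 (hζ.modelPair q r.2.1 r.2.2).flip (hζ.modelPair q r.2.1 r.2.2)
  have hφ : Function.Injective φ := by
    have h0 : ∀ x y x' y', hζ.modelPair q x y = hζ.modelPair q x' y' → x = x' ∧ y = y' := by
      intro x y x' y' e
      have e0 := congrArg (fun q => q.sheet 0) e
      have e1 := congrArg (fun q => q.sheet 1) e
      simp only [modelPair_sheet] at e0 e1
      exact ⟨(hζ.modelVertex_injective q _ _ _ _ e0).2, (hζ.modelVertex_injective q _ _ _ _ e1).2⟩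
    have h1 : ∀ x y x' y', hζ.modelPair q x y ≠ (hζ.modelPair q x' y').flip := by
      intro x y x' y' e
      have e0 := congrArg (fun q => q.sheet 0) e
      simp only [modelPair_sheet, modelPair_flip_sheet] at e0
      exact absurd (hζ.modelVertex_injective q _ _ _ _ e0).1 (by decide)
    rintro ⟨_ | _, x, y⟩ ⟨_ | _, x', y'⟩ e
    · obtain ⟨rfl, rfl⟩ := h0 _ _ _ _ e
      rfl
    · exact absurd e (h1 _ _ _ _)
    · exact absurd e.symm (h1 _ _ _ _)
    · obtain ⟨rfl, rfl⟩ := h0 _ _ _ _ (congrArg NoncommutingPair.flip e)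
      rfl
  have hr : {q' : NoncommutingPair G | component q' = component q} = Set.range φ := by
    ext q'
    have : component q' = component q ↔ q'.sheet 0 ∈ (component q).supp := Iff.rfl
    change component q' = component q ↔ _
    rw [this, hζ.sheet_mem_supp_component_iff]
    constructor
    · rintro ⟨x, y, rfl | rfl⟩
      exacts [⟨(false, x, y), rfl⟩, ⟨(true, x, y), rfl⟩]
    · rintro ⟨⟨_ | _, x, y⟩, rfl⟩
      exacts [⟨x, y, .inl rfl⟩, ⟨x, y, .inr rfl⟩]
  change Nat.card {q' : NoncommutingPair G | component q' = component q} = _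
  rw [hr, Nat.card_range_of_injective hφ]
  simp [sq]

theorem card_component_mul [Finite G] (hζ : IsCentralParam ζ) :
    Nat.card (ComponentY G) * (2 * p ^ 2) = Nat.card (NoncommutingPair G) := by
  have : Finite (ComponentY G) := Finite.of_surjective _ hζ.component_surjective
  have := Fintype.ofFinite (ComponentY G)
  rw [Nat.card_congr (Equiv.sigmaFiberEquiv (component : NoncommutingPair G → _)).symm,
    Nat.card_sigma]
  simp only [hζ.card_fiber]
  simp

end IsCentralParam

end ComponentModels

/-! ### Coordinates on `U3 p` and the number of components -/

section Unitriangular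

open Matrix

variable (p : ℕ) [Fact p.Prime]

/-- The unitriangular matrices with given coordinates. -/
def U3.mk (a b c : ZMod p) : U3 p :=
  ⟨⟨!![1, a, b; 0, 1, c; 0, 0, 1], !![1, -a, a * c - b; 0, 1, -c; 0, 0, 1], by
    ext i j
    fin_cases i <;> fin_cases j <;> simp [Matrix.mul_apply, Fin.sum_univ_three]
    ring, by
    ext i j
    fin_cases i <;> fin_cases j <;> simp [Matrix.mul_apply, Fin.sum_univ_three]
    ring⟩, a, b, c, rfl⟩

variable {p}

theorem U3.mk_mul (a b c a' b' c' : ZMod p) :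
    U3.mk p a b c * U3.mk p a' b' c' = U3.mk p (a' + a) (b' + a * c' + b) (c' + c) := by
  apply Subtype.ext
  apply Units.ext
  ext i j
  fin_cases i <;> fin_cases j <;> simp [U3.mk, Matrix.mul_apply, Fin.sum_univ_three]

theorem U3.mk_inj {a b c a' b' c' : ZMod p} :
    U3.mk p a b c = U3.mk p a' b' c' ↔ a = a' ∧ b = b' ∧ c = c' := by
  constructor
  · intro h
    have hm : !![1, a, b; 0, 1, c; 0, 0, 1] = !![1, a', b'; 0, 1, c'; 0, 0, (1 : ZMod p)] :=
      congrArg (fun A : U3 p => ((A : GL (Fin 3) (ZMod p)) : Matrix (Fin 3) (Fin 3) (ZMod p))) h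
    exact ⟨congrFun (congrFun hm 0) 1, congrFun (congrFun hm 0) 2, congrFun (congrFun hm 1) 2⟩
  · rintro ⟨rfl, rfl, rfl⟩
    rfl

theorem U3.exists_eq_mk (A : U3 p) : ∃ a b c, A = U3.mk p a b c := by
  obtain ⟨A, a, b, c, h⟩ := A
  exact ⟨a, b, c, Subtype.ext (Units.ext h)⟩

theorem U3.isCentralParam : IsCentralParam fun t : ZMod p => U3.mk p 0 t 0 where
  add s t := by simp [U3.mk_mul, add_comm]
  inj s t h := (U3.mk_inj.1 h).2.1
  mem_center g := by
    rw [Subgroup.mem_center_iff]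
    constructor
    · intro h
      obtain ⟨a, b, c, rfl⟩ := U3.exists_eq_mk g
      have h1 := h (U3.mk p 1 0 0)
      have h2 := h (U3.mk p 0 0 1)
      simp only [U3.mk_mul, U3.mk_inj] at h1 h2
      have hc : c = 0 := by linear_combination h1.2.1
      have ha : a = 0 := by linear_combination -h2.2.1
      exact ⟨b, by rw [hc, ha]⟩
    · rintro ⟨t, rfl⟩ g
      obtain ⟨a, b, c, rfl⟩ := U3.exists_eq_mk g
      simp [U3.mk_mul, add_comm]
  comm x y := by
    obtain ⟨a, b, c, rfl⟩ := U3.exists_eq_mk x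
    obtain ⟨a', b', c', rfl⟩ := U3.exists_eq_mk y
    refine ⟨a * c' - a' * c, ?_⟩
    simp only [U3.mk_mul, U3.mk_inj]
    refine ⟨by ring, by ring, by ring⟩

/-- The commutator of two matrices is the determinant of the `2 × 2` matrix formed by their
superdiagonals `(a, c)` and `(a', c')`, while the corner entries `b` and `b'` are free. -/
theorem U3.card_noncommutingPair :
    Nat.card (NoncommutingPair (U3 p)) = p ^ 2 * ((p ^ 2 - 1) * (p ^ 2 - p)) := by
  let φ : (ZMod p × ZMod p) × GL (Fin 2) (ZMod p) → U3 p × U3 p := fun r =>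
    (U3.mk p (r.2 0 0) r.1.1 (r.2 0 1), U3.mk p (r.2 1 0) r.1.2 (r.2 1 1))
  have hφ : Function.Injective φ := by
    rintro ⟨⟨b, b'⟩, A⟩ ⟨⟨d, d'⟩, B⟩ e
    simp only [φ, Prod.mk.injEq, U3.mk_inj] at e
    obtain ⟨⟨h1, rfl, h2⟩, h3, rfl, h4⟩ := e
    have : A = B := by
      apply Units.ext
      ext i j
      fin_cases i <;> fin_cases j
      exacts [h1, h2, h3, h4]
    rw [this]
  have hr : {q : U3 p × U3 p | q.1 * q.2 ≠ q.2 * q.1} = Set.range φ := by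
    ext ⟨x, y⟩
    obtain ⟨a, b, c, rfl⟩ := U3.exists_eq_mk x
    obtain ⟨a', b', c', rfl⟩ := U3.exists_eq_mk y
    constructor
    · intro h
      have hdet : (!![a, c; a', c']).det ≠ 0 := by
        rw [Matrix.det_fin_two_of]
        intro h0
        apply h
        simp only [U3.mk_mul, U3.mk_inj]
        exact ⟨by ring, by linear_combination h0, by ring⟩
      exact ⟨((b, b'), Matrix.GeneralLinearGroup.mkOfDetNeZero _ hdet), rfl⟩
    · rintro ⟨⟨⟨d, d'⟩, A⟩, e⟩
      simp only [φ, Prod.mk.injEq, U3.mk_inj] at e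
      obtain ⟨⟨rfl, rfl, rfl⟩, rfl, rfl, rfl⟩ := e
      intro h
      simp only [U3.mk_mul, U3.mk_inj] at h
      have hdet : A.1.det ≠ 0 := by
        have := A.isUnit.map (Matrix.detMonoidHom)
        exact this.ne_zero
      rw [Matrix.det_fin_two] at hdet
      exact hdet (by linear_combination h.2.1)
  change Nat.card {q : U3 p × U3 p | q.1 * q.2 ≠ q.2 * q.1} = _
  rw [hr, Nat.card_range_of_injective hφ, Nat.card_prod, Matrix.card_GL_field]
  simp [Fin.prod_univ_two, sq]

theorem U3.card_componentY :
    Nat.card (ComponentY (U3 p)) = (p ^ 2 - 1) * (p ^ 2 - p) / 2 := by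
  have h := U3.isCentralParam.card_component_mul (G := U3 p)
  rw [U3.card_noncommutingPair] at h
  have hp0 : 0 < p ^ 2 := pow_pos (Fact.out : p.Prime).pos 2
  have h2 : Nat.card (ComponentY (U3 p)) * 2 = (p ^ 2 - 1) * (p ^ 2 - p) :=
    Nat.eq_of_mul_eq_mul_left hp0 (by rw [← h]; ring)
  omega

end Unitriangular

theorem mainTheorem5 (p : ℕ) [Fact p.Prime] (hp : Odd p) :
    Nat.card (ComponentY (U3 p)) = (p ^ 2 - 1) * (p ^ 2 - p) / 2 ∧
    (∀ T T' : ComponentY (U3 p), Nonempty (T.CellPoset ≃o T'.CellPoset)) ∧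
    ∀ T : ComponentY (U3 p),
      IsRegularPolytope T.CellPoset 3 ∧
      HasSchlafliSymbol T.CellPoset (2 * p) p ∧
      T.triangulation.IsSurfaceOfGenus (p * (p - 3) / 2 + 1) ∧
      T.faceCells.ncard = p ∧
      T.edgeCells.ncard = p ^ 2 ∧
      T.vertexCells.ncard = 2 * p ∧
      (∀ f ∈ T.faceCells, {e ∈ T.edgeCells | e ⊆ f}.ncard = 2 * p) ∧
      (∀ v ∈ T.vertexCells, {e ∈ T.edgeCells | v ⊆ e}.ncard = p) := by
  refine ⟨U3.card_componentY, fun T T' => ?_, fun T => ?_⟩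
  · obtain ⟨f, h⟩ := U3.isCentralParam.exists_isModel T
    obtain ⟨f', h'⟩ := U3.isCentralParam.exists_isModel T'
    obtain ⟨φ⟩ := h.nonempty_orderIso
    obtain ⟨φ'⟩ := h'.nonempty_orderIso
    exact ⟨φ.symm.trans φ'⟩
  · obtain ⟨f, h⟩ := U3.isCentralParam.exists_isModel T
    obtain ⟨φ⟩ := h.nonempty_orderIso
    exact ⟨(BipartiteCell.isRegularPolytope p).of_orderIso φ,
      BipartiteCell.hasSchlafliSymbol.of_orderIso φ, h.tri.isSurfaceOfGenus hp,
      h.ncard_faceCells, h.ncard_edgeCells, h.ncard_vertexCells, h.ncard_edges_of_face,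
      h.ncard_edges_of_vertex⟩
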